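/- **Setting.** Let $G$ be a finite directed acyclic graph (DAG) with vertex set $V$ and edge set $E$. A *trek* between $i$ and $j$ is a path without repeated vertices and without colliders; equivalently, a pair $(P_i,P_j)$ of directed paths from a common source $\mathrm{top}$ to $i$ and to $j$ that share only the vertex $\mathrm{top}$. (The only trek from $i$ to $i$ is the trivial one.) Work in $\mathbb C[\Sigma]=\mathbb{C}[\sigma_{ij}: i,j\in V]$ with $\sigma_{ij}=\sigma_{ji}$. * The *vanishing ideal* $I_G$ is the ideal of all $f\in\mathbb{C}[\Sigma]$ with $f\big((\mathrm{Id}-L)^{-T}\,\Omega\,(\mathrm{Id}-L)^{-1}\big)=0$ for all real matrices $L=(\lambda_{ij})$ with $\lambda_{ij}=0$ unless $i\to j\in E$, and all diagonal matrices $\Omega$ with positive diagonal entries. * $ST_G$ *is defined* if between any two vertices there is no trek or a unique shortest trek $i\leftrightarrow j$. Then $ST_G$ is the kernel of the map $\psi_G:\mathbb C[\Sigma]\to\mathbb C[a_i,\lambda_{kl}: i\in V,\ k\to l\in E]$ that sends $\sigma_{ij}$ to $a_{\mathrm{top}(i\leftrightarrow j)}\prod_{k\to l\in i\leftrightarrow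 j}\lambda_{kl}$ if there is a trek between $i$ and $j$ and to $0$ otherwise (so $\sigma_{ii}\mapsto a_i$). * An ideal of a polynomial ring over $\mathbb{C}$ is *toric* if it is the kernel of a monomial map, that is, of a $\mathbb{C}$-algebra homomorphism to a Laurent polynomial ring $\mathbb{C}[t_1^{\pm1},\dots,t_d^{\pm1}]$ that sends each indeterminate to a Laurent monomial or to $0$. * A vertex $c$ is a *choke point* between sets $I$ and $J$ of vertices if every trek $(P_i,P_j)$ from some $i\in I$ to some $j\in J$ contains $c$, and either $c$ lies on $P_i$ for all these treks or $c$ lies on $P_j$ for all these treks. * Let $G_1,G_2$ be DAGs with $V(G_1)\cap V(G_2)=C=\{c\}\sqcup D$ that induce the same complete DAG on $C$. Their clique sum $G$ has vertex set $V(G_1)\cup V(G_2)$ and edge set $E(G_1)\cup E(G_2)$. It is a *safe gluing at the $N$-clique $C$ ($N=|C|$) with choke point $c$* if, in $G$, (i) $c$ is a choke point between $V(G_1)\setminus D$ and $V(G_2)\setminus D$, and (ii) no trek from a vertex of $V(G_1)\setminus D$ to a vertex of $V(G_2)\setminus D$ contains a vertex of $D$. If $C=\{c\}$ and there is no trek between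 $V(G_1)\setminus\{c\}$ and $V(G_2)\setminus\{c\}$, then $G$ is also called a safe gluing. **Theorem.** Let $G$ be a safe gluing of $G_1$ and $G_2$ at an $N$-clique with choke point $c$. Suppose that, for $k=1,2$, $ST_{G_k}$ is defined and $I_{G_k}=ST_{G_k}$, and that $I_{G_1}$ and $I_{G_2}$ have generating sets such that no indeterminate other than $\sigma_{cc}$ occurs in both of them. Then $ST_G$ is defined and $I_G=ST_G$; hence $I_G$ is toric. -/

import Mathlib

/-- A directed acyclic graph on the vertex type `V`; `G.Adj i j` is the edge `i → j`. -/
structure DAG (V : Type*) where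
  Adj : V → V → Prop
  acyclic : ∀ v, ¬ Relation.TransGen Adj v v

/-- A (simple) trek between `i` and `j`: a pair of directed paths `top → ⋯ → i` and
`top → ⋯ → j` with common source `top` that share no vertex but `top`. The two lists hold the
vertices after `top` on the two paths. This is the same as a path without repeated vertices
and without colliders. -/
@[ext]
structure DAG.Trek {V : Type*} (G : DAG V) (i j : V) where
  top : V
  left : List V
  right : List V
  left_chain : (top :: left).IsChain G.Adj
  right_chain : (top :: right).IsChain G.Adj
  left_end : (top :: left).getLast (List.cons_ne_nil _ _) = i
  right_end : (top :: right).getLast (List.cons_ne_nil _ _) = j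
  nodup : (top :: (left ++ right)).Nodup

/-- The vertices of the directed path from the top to the first end point. -/
def DAG.Trek.leftSide {V : Type*} {G : DAG V} {i j : V} (P : G.Trek i j) : List V :=
  P.top :: P.left

/-- The vertices of the directed path from the top to the second end point. -/
def DAG.Trek.rightSide {V : Type*} {G : DAG V} {i j : V} (P : G.Trek i j) : List V :=
  P.top :: P.right

/-- All vertices of the trek. -/
def DAG.Trek.support {V : Type*} {G : DAG V} {i j : V} (P : G.Trek i j) : List V :=
  P.top :: (P.left ++ P.right)

/-- The number of edges of the trek. -/
def DAG.Trek.length {V : Type*} {G : DAG V} {i j : V} (P : G.Trek i j) : ℕ :=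
  P.left.length + P.right.length

/-- The directed edges of the trek. -/
def DAG.Trek.edges {V : Type*} {G : DAG V} {i j : V} (P : G.Trek i j) : List (V × V) :=
  (P.top :: P.left).zip P.left ++ (P.top :: P.right).zip P.right

/-- The trek read from `j` to `i`. -/
def DAG.Trek.symm {V : Type*} {G : DAG V} {i j : V} (P : G.Trek i j) : G.Trek j i where
  top := P.top
  left := P.right
  right := P.left
  left_chain := P.right_chain
  right_chain := P.left_chain
  left_end := P.right_end
  right_end := P.left_end
  nodup := ((List.perm_append_comm (l₁ := P.left) (l₂ := P.right)).cons P.top).nodup P.nodup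

def DAG.Trek.IsShortest {V : Type*} {G : DAG V} {i j : V} (P : G.Trek i j) : Prop :=
  ∀ Q : G.Trek i j, P.length ≤ Q.length

/-- Between any two vertices there is no trek or a unique shortest trek: the condition under
which the shortest trek map is defined. -/
def DAG.HasUniqueShortestTreks {V : Type*} (G : DAG V) : Prop :=
  ∀ i j, Nonempty (G.Trek i j) → ∃! P : G.Trek i j, P.IsShortest

/-- The type of edges. -/
abbrev DAG.Edge {V : Type*} (G : DAG V) : Type _ := {e : V × V // G.Adj e.1 e.2}

/-! ### The vanishing ideal -/

open Classical in
/-- The covariance matrix `(I - L)⁻ᵀ D (I - L)⁻¹`, with `L` the matrix of the regression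
coefficients on the edges and `D` the diagonal matrix of the error variances. -/
noncomputable def DAG.covariance {V : Type*} [Fintype V] (G : DAG V) (lam : V → V → ℝ)
    (om : V → ℝ) : Matrix V V ℝ :=
  let L : Matrix V V ℝ := Matrix.of fun i j => if G.Adj i j then lam i j else 0
  ((1 - L)⁻¹).transpose * Matrix.diagonal om * (1 - L)⁻¹

/-- The Gaussian model of `G`, as a set of points with coordinates `σ_{ij}`, where the
unordered pair `s(i, j)` is the index of `σ_{ij} = σ_{ji}`. -/
def DAG.model {V : Type*} [Fintype V] (G : DAG V) : Set (Sym2 V → ℂ) :=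
  {p | ∃ (lam : V → V → ℝ) (om : V → ℝ), (∀ i, 0 < om i) ∧
    ∀ i j, p s(i, j) = ((G.covariance lam om i j : ℝ) : ℂ)}

/-- The vanishing ideal `I_G ⊆ ℂ[σ_{ij}]` of the Gaussian model of `G`. -/
noncomputable def DAG.vanishingIdeal {V : Type*} [Fintype V] (G : DAG V) :
    Ideal (MvPolynomial (Sym2 V) ℂ) :=
  MvPolynomial.vanishingIdeal ℂ G.model

/-! ### The shortest trek ideal -/

open Classical in
/-- The monomial `a_{top} ∏ λ_{kl}`, the product over the edges `k → l` of the trek, in the ring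
`ℂ[a_i, λ_{kl} : i ∈ V, k → l ∈ E]`. -/
noncomputable def DAG.Trek.monomial {V : Type*} [Fintype V] {G : DAG V} {i j : V}
    (P : G.Trek i j) : MvPolynomial (V ⊕ G.Edge) ℂ :=
  MvPolynomial.X (Sum.inl P.top) *
    ∏ e : G.Edge, if e.1 ∈ P.edges then MvPolynomial.X (Sum.inr e) else 1

open Classical in
/-- The image of `σ_{ij}` under the shortest trek map: the monomial of a shortest trek between
`i` and `j` (of the unique one, if `G.HasUniqueShortestTreks`; from `i` to `i` it is the trivial
trek, with monomial `a_i`), and `0` if there is no trek between `i` and `j`. -/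
noncomputable def DAG.shortestTrekMonomial {V : Type*} [Fintype V] (G : DAG V) (s : Sym2 V) :
    MvPolynomial (V ⊕ G.Edge) ℂ :=
  if h : ∃ P : (Σ i j : V, G.Trek i j), s(P.1, P.2.1) = s ∧ P.2.2.IsShortest then
    h.choose.2.2.monomial
  else 0

/-- The shortest trek map `ψ_G`. -/
noncomputable def DAG.shortestTrekMap {V : Type*} [Fintype V] (G : DAG V) :
    MvPolynomial (Sym2 V) ℂ →ₐ[ℂ] MvPolynomial (V ⊕ G.Edge) ℂ :=
  MvPolynomial.aeval G.shortestTrekMonomial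

/-- The shortest trek ideal `ST_G`, meaningful if `G.HasUniqueShortestTreks`. -/
noncomputable def DAG.shortestTrekIdeal {V : Type*} [Fintype V] (G : DAG V) :
    Ideal (MvPolynomial (Sym2 V) ℂ) :=
  RingHom.ker G.shortestTrekMap

theorem DAG.Trek.monomial_symm {V : Type*} [Fintype V] {G : DAG V} {i j : V}
    (P : G.Trek i j) : P.symm.monomial = P.monomial := by
  unfold DAG.Trek.monomial
  congr 1
  refine Finset.prod_congr rfl fun e _ => ?_
  have : (e.1 ∈ P.symm.edges) ↔ (e.1 ∈ P.edges) := by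
    simp only [DAG.Trek.edges, DAG.Trek.symm, List.mem_append]
    exact or_comm
  by_cases h : e.1 ∈ P.edges
  · rw [if_pos h, if_pos (this.mpr h)]
  · rw [if_neg h, if_neg (fun h' => h (this.mp h'))]

theorem DAG.Trek.IsShortest.symm {V : Type*} {G : DAG V} {i j : V} {P : G.Trek i j}
    (h : P.IsShortest) : P.symm.IsShortest := fun Q => by
  have := h Q.symm
  simp only [DAG.Trek.length, DAG.Trek.symm] at this ⊢
  omega

/-- Where shortest treks are unique, the shortest trek map sends `σ_{ij}` to the monomial of
the shortest trek between `i` and `j`. -/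
theorem DAG.shortestTrekMap_X {V : Type*} [Fintype V] {G : DAG V}
    (hG : G.HasUniqueShortestTreks) {i j : V} (P : G.Trek i j) (hP : P.IsShortest) :
    G.shortestTrekMap (MvPolynomial.X s(i, j)) = P.monomial := by
  have h : ∃ Q : (Σ i j : V, G.Trek i j), s(Q.1, Q.2.1) = s(i, j) ∧ Q.2.2.IsShortest :=
    ⟨⟨i, j, P⟩, rfl, hP⟩
  rw [DAG.shortestTrekMap, MvPolynomial.aeval_X, DAG.shortestTrekMonomial, dif_pos h]
  obtain ⟨h1, h2⟩ := h.choose_spec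
  generalize h.choose = R at h1 h2
  obtain ⟨k, l, Q⟩ := R
  rcases Sym2.eq_iff.mp h1 with ⟨hk, hl⟩ | ⟨hk, hl⟩
  · dsimp only at hk hl
    subst hk hl
    rw [(hG _ _ ⟨P⟩).unique hP h2]
  · dsimp only at hk hl
    subst hk hl
    rw [(hG _ _ ⟨P⟩).unique hP h2.symm, DAG.Trek.monomial_symm]

/-- The shortest trek map sends `σ_{ij}` to `0` if there is no trek between `i` and `j`. -/
theorem DAG.shortestTrekMap_X_of_isEmpty {V : Type*} [Fintype V] {G : DAG V} {i j : V}
    (h : IsEmpty (G.Trek i j)) : G.shortestTrekMap (MvPolynomial.X s(i, j)) = 0 := by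
  rw [DAG.shortestTrekMap, MvPolynomial.aeval_X, DAG.shortestTrekMonomial, dif_neg]
  rintro ⟨⟨k, l, Q⟩, h1, -⟩
  rcases Sym2.eq_iff.mp h1 with ⟨hk, hl⟩ | ⟨hk, hl⟩
  · dsimp only at hk hl
    subst hk hl
    exact h.false Q
  · dsimp only at hk hl
    subst hk hl
    exact h.false Q.symm

/-! ### Toric ideals -/

/-- An ideal is toric if it is the kernel of a monomial map into a Laurent polynomial ring
`ℂ[t_1^{±1}, …, t_d^{±1}]` (the group algebra of `ℤ^d`): each indeterminate is sent to a Laurent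
monomial or to `0`. -/
def IsToricIdeal {S : Type*} (I : Ideal (MvPolynomial S ℂ)) : Prop :=
  ∃ (d : ℕ) (f : MvPolynomial S ℂ →ₐ[ℂ] AddMonoidAlgebra ℂ (Fin d → ℤ)),
    (∀ s, f (MvPolynomial.X s) = 0 ∨
      ∃ a : Fin d → ℤ, f (MvPolynomial.X s) = AddMonoidAlgebra.single a 1) ∧
    RingHom.ker f = I

/-! ### Safe gluing -/

/-- `c` is a choke point between `I` and `J`: every trek from `I` to `J` contains `c`, and `c` is
on the `I`-side of all of them or on the `J`-side of all of them. -/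
def DAG.IsChokePoint {V : Type*} (G : DAG V) (c : V) (I J : Set V) : Prop :=
  (∀ i ∈ I, ∀ j ∈ J, ∀ P : G.Trek i j, c ∈ P.support) ∧
  ((∀ i ∈ I, ∀ j ∈ J, ∀ P : G.Trek i j, c ∈ P.leftSide) ∨
   (∀ i ∈ I, ∀ j ∈ J, ∀ P : G.Trek i j, c ∈ P.rightSide))

/-- `G` is the clique sum at `C` of `G₁`, with vertex set `V₁`, and `G₂`, with vertex set `V₂`:
`V₁` and `V₂` cover the vertices of `G` and meet in `C`, the two graphs induce the same complete
DAG on `C`, and the edges of `G` are those of `G₁` and those of `G₂`. -/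
structure DAG.IsCliqueSum {V : Type*} (G : DAG V) {V₁ V₂ : Finset V} (G₁ : DAG V₁)
    (G₂ : DAG V₂) (C : Finset V) : Prop where
  cover : ∀ v, v ∈ V₁ ∨ v ∈ V₂
  inter : ∀ v, v ∈ V₁ ∧ v ∈ V₂ ↔ v ∈ C
  same : ∀ u v : V, u ∈ C → v ∈ C → ∀ (hu₁ : u ∈ V₁) (hv₁ : v ∈ V₁) (hu₂ : u ∈ V₂) (hv₂ : v ∈ V₂),
    G₁.Adj ⟨u, hu₁⟩ ⟨v, hv₁⟩ ↔ G₂.Adj ⟨u, hu₂⟩ ⟨v, hv₂⟩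
  complete : ∀ u v : V, u ∈ C → v ∈ C → u ≠ v → ∀ (hu : u ∈ V₁) (hv : v ∈ V₁),
    G₁.Adj ⟨u, hu⟩ ⟨v, hv⟩ ∨ G₁.Adj ⟨v, hv⟩ ⟨u, hu⟩
  adj : ∀ u v : V, G.Adj u v ↔
    (∃ (hu : u ∈ V₁) (hv : v ∈ V₁), G₁.Adj ⟨u, hu⟩ ⟨v, hv⟩) ∨
    (∃ (hu : u ∈ V₂) (hv : v ∈ V₂), G₂.Adj ⟨u, hu⟩ ⟨v, hv⟩)

/-- `G` is a safe gluing of `G₁` and `G₂` at the clique `C = {c} ∪ D` with choke point `c`. In the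
second alternative the graphs are glued at the single vertex `c` and no trek joins the two sides
(as when a common sink is identified); this also counts as a safe gluing. -/
structure DAG.IsSafeGluing {V : Type*} [DecidableEq V] (G : DAG V) {V₁ V₂ : Finset V}
    (G₁ : DAG V₁) (G₂ : DAG V₂) (c : V) (D : Finset V) : Prop where
  not_mem : c ∉ D
  cliqueSum : G.IsCliqueSum G₁ G₂ (insert c D)
  safe :
    (G.IsChokePoint c (↑V₁ \ ↑D) (↑V₂ \ ↑D) ∧
      ∀ i ∈ (↑V₁ \ ↑D : Set V), ∀ j ∈ (↑V₂ \ ↑D : Set V), ∀ P : G.Trek i j,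
        ∀ d ∈ D, d ∉ P.support) ∨
    (D = ∅ ∧ ∀ i ∈ V₁, i ≠ c → ∀ j ∈ V₂, j ≠ c → IsEmpty (G.Trek i j))

/-- The ideals `I₁` and `I₂` have generating sets such that an indeterminate that occurs in both
of them can only be `σ_{cc}`. -/
def GeneratorsShareAtMost {V : Type*} {V₁ V₂ : Finset V} (c : V)
    (I₁ : Ideal (MvPolynomial (Sym2 V₁) ℂ)) (I₂ : Ideal (MvPolynomial (Sym2 V₂) ℂ)) : Prop :=
  ∃ (S₁ : Set (MvPolynomial (Sym2 V₁) ℂ)) (S₂ : Set (MvPolynomial (Sym2 V₂) ℂ)),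
    Ideal.span S₁ = I₁ ∧ Ideal.span S₂ = I₂ ∧
    ∀ f ∈ S₁, ∀ g ∈ S₂, ∀ s ∈ f.vars, ∀ t ∈ g.vars,
      s.map Subtype.val = t.map Subtype.val → s.map Subtype.val = s(c, c)

open scoped InnerProductSpace

/-! A point of the model is the Gram matrix of vectors `X j` that satisfy the structural equations
of the graph with orthogonal nonzero errors, so covariances can be handled as inner products
(`Realizes.mem_model`, `exists_realizes_of_mem_model`).

To prove I_G = ST_G it suffices to rewrite each σ_ij, up to a product of diagonal indeterminates, as
a polynomial in the σ_vv and the σ_kl of edges, modulo both ideals at once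
(`vanishingIdeal_eq_shortestTrekIdeal`). Neither ideal contains a nonzero polynomial in these
coordinates: ψ_G sends them to the algebraically independent monomials a_v and a_k λ_kl, and on the
model they are local coordinates near the identity matrix. Diagonal factors cancel in both ideals,
since ψ_G maps to a domain and variances are positive.

If i and j lie on the same side, the rewriting comes from that side. Marginals of the model of G
belong to the model of G_k (`IsMarginal.exists_realizes`), and shortest treks between vertices of
V_k stay in V_k (`IsMarginal.exists_contracted_trek`). The statement on marginals needs nested
parent sets at the clique vertices that are entered from the other side. These follow from I = ST
for G_k: a missing edge would give a binomial in ST but not in I (`adj_of_vanishingIdeal_eq`).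

If i and j lie on different sides, either there is no trek between them and σ_ij is in both ideals,
or, up to swapping the sides, c cuts every trek into a directed path from c and a trek ending at c.
Then shortest treks are concatenations of shortest treks, and σ_cc σ_ij − σ_ic σ_cj lies in both
ideals. -/

namespace DAG

/-! ### Points of the model as Gram matrices -/

section Vectors

variable {V : Type*} (G : DAG V)

theorem wellFounded_adj [Finite V] : WellFounded G.Adj :=
  have : Std.Irrefl (Relation.TransGen G.Adj) := ⟨G.acyclic⟩
  Subrelation.wf (fun h => Relation.TransGen.single h)
    (Finite.wellFounded_of_trans_of_irrefl (Relation.TransGen G.Adj))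

open Classical in
/-- The matrix of the regression coefficients on the edges of `G`. -/
noncomputable def coeff (lam : V → V → ℝ) : Matrix V V ℝ :=
  Matrix.of fun i j => if G.Adj i j then lam i j else 0

variable {G}

theorem coeff_of_adj {lam : V → V → ℝ} {i j : V} (h : G.Adj i j) : G.coeff lam i j = lam i j := by
  simp [coeff, h]

theorem coeff_of_not_adj {lam : V → V → ℝ} {i j : V} (h : ¬ G.Adj i j) :
    G.coeff lam i j = 0 := by
  simp [coeff, h]

theorem coeff_eq_self {lam : V → V → ℝ} (h : ∀ i j, ¬ G.Adj i j → lam i j = 0) (i j : V) :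
    G.coeff lam i j = lam i j := by
  by_cases h' : G.Adj i j
  · exact coeff_of_adj h'
  · rw [coeff_of_not_adj h', h i j h']

variable [Fintype V]

-- A row vector with v = vL has each entry determined by the entries at the parents, so it vanishes
-- by induction along the acyclic order.
variable (G) in
theorem isUnit_one_sub_coeff [DecidableEq V] (lam : V → V → ℝ) :
    IsUnit (1 - G.coeff lam) := by
  rw [← Matrix.vecMul_injective_iff_isUnit, ← Matrix.coe_vecMulLinear, ← LinearMap.ker_eq_bot,
    LinearMap.ker_eq_bot']
  intro v hv
  ext j
  induction j using G.wellFounded_adj.induction with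
  | _ j ih =>
    have h := congrFun hv j
    simp only [Matrix.vecMulLinear_apply, Matrix.vecMul_sub, Matrix.vecMul_one,
      Pi.sub_apply, Pi.zero_apply, sub_eq_zero] at h
    rw [h, Matrix.vecMul, dotProduct]
    refine Finset.sum_eq_zero fun k _ => ?_
    by_cases hk : G.Adj k j
    · simp [ih k hk]
    · simp [coeff_of_not_adj hk]

theorem covariance_apply [DecidableEq V] (lam : V → V → ℝ) (om : V → ℝ) (i j : V) :
    G.covariance lam om i j =
      ∑ v, om v * (1 - G.coeff lam)⁻¹ v i * (1 - G.coeff lam)⁻¹ v j := by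
  have h : G.covariance lam om = ((1 - G.coeff lam)⁻¹).transpose * Matrix.diagonal om *
      (1 - G.coeff lam)⁻¹ := by
    unfold covariance coeff
    congr!
  rw [h, Matrix.mul_apply]
  refine Finset.sum_congr rfl fun v _ => ?_
  rw [Matrix.mul_diagonal, Matrix.transpose_apply, mul_comm (om v)]

variable {E : Type*} [NormedAddCommGroup E] [InnerProductSpace ℝ E]

variable (G) in
/-- What remains of `X j` after subtracting the combination of its parents. -/
noncomputable def residual (lam : V → V → ℝ) (X : V → E) (j : V) : E :=
  X j - ∑ k, G.coeff lam k j • X k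

variable (G) in
/-- The vectors `X j` satisfy the structural equations of `G` with uncorrelated errors. -/
structure Realizes (lam : V → V → ℝ) (X : V → E) : Prop where
  ne_zero : ∀ j, G.residual lam X j ≠ 0
  orthogonal : ∀ i j, i ≠ j → ⟪G.residual lam X i, G.residual lam X j⟫_ℝ = 0

theorem eq_residual_add (lam : V → V → ℝ) (X : V → E) (j : V) :
    X j = G.residual lam X j + ∑ k, G.coeff lam k j • X k := by
  simp [residual]

/-- The residuals are obtained from `X` by applying 1 − L; inverting, `X` is a combination of
orthogonal residuals, whose squared norms serve as the error variances. -/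
theorem Realizes.mem_model {lam : V → V → ℝ} {X : V → E} (h : G.Realizes lam X)
    {p : Sym2 V → ℂ} (hp : ∀ i j, p s(i, j) = ((⟪X i, X j⟫_ℝ : ℝ) : ℂ)) : p ∈ G.model := by
  classical
  refine ⟨lam, fun v => ‖G.residual lam X v‖ ^ 2, fun v => ?_, fun i j => ?_⟩
  · have := norm_pos_iff.mpr (h.ne_zero v)
    positivity
  rw [hp]
  congr 1
  set N := (1 - G.coeff lam)⁻¹ with hN
  have hmul : (1 - G.coeff lam) * N = 1 :=
    Matrix.mul_nonsing_inv _ ((Matrix.isUnit_iff_isUnit_det _).mp (G.isUnit_one_sub_coeff lam))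
  have hX : ∀ j, X j = ∑ v, N v j • G.residual lam X v := by
    intro j
    have h1 : ∀ v, G.residual lam X v = ∑ k, (1 - G.coeff lam) k v • X k := by
      intro v
      simp [residual, sub_smul, Matrix.one_apply, Finset.sum_sub_distrib]
    simp_rw [h1, Finset.smul_sum, smul_smul]
    rw [Finset.sum_comm]
    have h2 : ∀ k, ∑ v, (N v j * (1 - G.coeff lam) k v) • X k =
        (1 : Matrix V V ℝ) k j • X k := by
      intro k
      have h3 : (1 : Matrix V V ℝ) k j = ∑ v, (1 - G.coeff lam) k v * N v j := by
        rw [← Matrix.mul_apply, hmul]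
      rw [h3, Finset.sum_smul]
      exact Finset.sum_congr rfl fun v _ => by rw [mul_comm]
    simp_rw [h2]
    simp [Matrix.one_apply]
  rw [covariance_apply, ← hN, hX i, hX j, sum_inner]
  refine Finset.sum_congr rfl fun v _ => ?_
  rw [inner_sum, Finset.sum_eq_single v]
  · rw [real_inner_smul_left, real_inner_smul_right, real_inner_self_eq_norm_sq]
    ring
  · intro w _ hw
    rw [real_inner_smul_left, real_inner_smul_right, h.orthogonal v w hw.symm]
    ring
  · simp

theorem exists_realizes_of_mem_model {p : Sym2 V → ℂ} (hp : p ∈ G.model) :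
    ∃ (lam : V → V → ℝ) (X : V → EuclideanSpace ℝ V), G.Realizes lam X ∧
      ∀ i j, p s(i, j) = ((⟪X i, X j⟫_ℝ : ℝ) : ℂ) := by
  classical
  obtain ⟨lam, om, hom, hp⟩ := hp
  set N := (1 - G.coeff lam)⁻¹ with hN
  have hmul : N * (1 - G.coeff lam) = 1 :=
    Matrix.nonsing_inv_mul _ ((Matrix.isUnit_iff_isUnit_det _).mp (G.isUnit_one_sub_coeff lam))
  -- The vectors are the columns of √Ω (1 − L)⁻¹; multiplying by 1 − L leaves √Ω, hence scaled basis
  -- vectors as errors.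
  have hres : ∀ j, G.residual lam (fun j => WithLp.toLp 2 fun v => √(om v) * N v j) j =
      EuclideanSpace.single j √(om j) := by
    intro j
    ext v
    have h1 := congrFun (congrFun hmul v) j
    rw [mul_sub, mul_one, Matrix.sub_apply, Matrix.mul_apply] at h1
    have h2 : ∑ k, G.coeff lam k j * (√(om v) * N v k) =
        √(om v) * ∑ k, N v k * G.coeff lam k j := by
      rw [Finset.mul_sum]
      exact Finset.sum_congr rfl fun k _ => by ring
    simp only [residual, PiLp.sub_apply, WithLp.ofLp_sum, WithLp.ofLp_smul, Finset.sum_apply,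
      Pi.smul_apply, smul_eq_mul, PiLp.single_apply]
    rw [h2, ← mul_sub, h1, Matrix.one_apply]
    by_cases hv : v = j
    · subst hv; simp
    · simp [hv]
  refine ⟨lam, fun j => WithLp.toLp 2 fun v => √(om v) * N v j, ⟨fun j => ?_, fun i j hij => ?_⟩,
    fun i j => ?_⟩
  · rw [hres]
    simpa using (Real.sqrt_pos.mpr (hom j)).ne'
  · rw [hres, hres, EuclideanSpace.inner_single_left, PiLp.single_apply, if_neg hij, mul_zero]
  · rw [hp, covariance_apply, ← hN]
    congr 1
    rw [PiLp.inner_apply]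
    refine Finset.sum_congr rfl fun v _ => ?_
    have := Real.mul_self_sqrt (hom v).le
    simp only [RCLike.inner_apply, conj_trivial]
    linear_combination (-(N v i * N v j)) * this

end Vectors

/-! ### Which errors a vector involves -/

section Span

variable {V : Type*} [Fintype V] {G : DAG V} {E : Type*} [NormedAddCommGroup E]
  [InnerProductSpace ℝ E] {lam : V → V → ℝ} {X : V → E}

variable (G lam X) in
/-- The span of the errors of the vertices in `S`. -/
noncomputable def errorSpan (S : Set V) : Submodule ℝ E :=
  Submodule.span ℝ (G.residual lam X '' S)

theorem residual_mem_errorSpan {S : Set V} {v : V} (hv : v ∈ S) :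
    G.residual lam X v ∈ G.errorSpan lam X S :=
  Submodule.subset_span ⟨v, hv, rfl⟩

theorem errorSpan_mono {S T : Set V} (h : S ⊆ T) :
    G.errorSpan lam X S ≤ G.errorSpan lam X T :=
  Submodule.span_mono (Set.image_mono h)

theorem Realizes.inner_eq_zero (h : G.Realizes lam X) {S T : Set V} (hST : Disjoint S T)
    {x y : E} (hx : x ∈ G.errorSpan lam X S) (hy : y ∈ G.errorSpan lam X T) :
    ⟪x, y⟫_ℝ = 0 := by
  refine Submodule.IsOrtho.inner_eq (U := G.errorSpan lam X S) (V := G.errorSpan lam X T) ?_ hx hy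
  refine Submodule.isOrtho_span.mpr ?_
  rintro _ ⟨s, hs, rfl⟩ _ ⟨t, ht, rfl⟩
  exact h.orthogonal s t fun hst => Set.disjoint_left.mp hST hs (hst ▸ ht)

theorem mem_errorSpan {S : Set V} (hS : ∀ u v, G.Adj u v → v ∈ S → u ∈ S) {v : V}
    (hv : v ∈ S) : X v ∈ G.errorSpan lam X S := by
  induction v using G.wellFounded_adj.induction with
  | _ v ih =>
    rw [eq_residual_add (G := G) lam X v]
    refine add_mem (residual_mem_errorSpan hv) (sum_mem fun k _ => ?_)
    by_cases hk : G.Adj k v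
    · exact Submodule.smul_mem _ _ (ih k hk (hS k v hk hv))
    · simp [coeff_of_not_adj hk]

/-- Unrolling the structural equations inside `S` can only stop at `c`. The coefficient `q` collects
the directed paths from `c` to `v`, so it is zero if there are none. -/
theorem exists_sub_smul_mem_errorSpan {S : Set V} {c : V}
    (hS : ∀ u v, G.Adj u v → v ∈ S → u ∈ S ∨ u = c) {v : V} (hv : v ∈ S) :
    ∃ q : ℝ, X v - q • X c ∈ G.errorSpan lam X S ∧
      (¬ Relation.TransGen G.Adj c v → q = 0) := by
  induction v using G.wellFounded_adj.induction with
  | _ v ih =>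
    have h : ∀ k, ∃ q : ℝ, G.coeff lam k v • X k - q • X c ∈ G.errorSpan lam X S ∧
        (¬ Relation.TransGen G.Adj c v → q = 0) := by
      intro k
      by_cases hk : G.Adj k v
      · rcases hS k v hk hv with h | rfl
        · obtain ⟨q, hq, hq'⟩ := ih k hk h
          refine ⟨G.coeff lam k v * q, ?_, fun hc => ?_⟩
          · rw [mul_smul, ← smul_sub]
            exact Submodule.smul_mem _ _ hq
          · rw [hq' fun h => hc (h.tail hk), mul_zero]
        · exact ⟨_, by rw [sub_self]; exact zero_mem _, fun hc => absurd (.single hk) hc⟩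
      · exact ⟨0, by simp [coeff_of_not_adj hk], fun _ => rfl⟩
    choose q hq hq' using h
    refine ⟨∑ k, q k, ?_, fun hc => Finset.sum_eq_zero fun k _ => hq' k hc⟩
    have : X v - (∑ k, q k) • X c =
        G.residual lam X v + ∑ k, (G.coeff lam k v • X k - q k • X c) := by
      rw [residual, Finset.sum_sub_distrib, Finset.sum_smul]
      abel
    rw [this]
    exact add_mem (residual_mem_errorSpan hv) (sum_mem fun k _ => hq k)

end Span

end DAG

/-! ### Marginals of the model -/

namespace DAG

variable {V : Type*} {G : DAG V}

/-- Conditions under which the model of `G₁` contains the marginals of the model of `G`: the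
subgraph of `G` on `V₁` is `G₁`, the other vertices are only entered from `c`, and their children
in `V₁` form a clique of children of `c`, with nested sets of parents. -/
structure IsMarginal (G : DAG V) {V₁ : Finset V} (G₁ : DAG V₁) (c : V) : Prop where
  mem : c ∈ V₁
  adj_iff : ∀ u v : V₁, G₁.Adj u v ↔ G.Adj u v
  entrance : ∀ u v, G.Adj u v → v ∉ V₁ → u ∉ V₁ ∨ u = c
  exit_clique : ∀ a b i j, a ∉ V₁ → b ∉ V₁ → i ∈ V₁ → j ∈ V₁ → G.Adj a i → G.Adj b j → i ≠ j →
    G.Adj i j ∨ G.Adj j i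
  exit_child : ∀ b j, b ∉ V₁ → j ∈ V₁ → G.Adj b j → j = c ∨ G.Adj c j
  nested : ∀ a b i j, a ∉ V₁ → b ∉ V₁ → i ∈ V₁ → j ∈ V₁ → G.Adj a i → G.Adj b j → G.Adj i j →
    ∀ k ∈ V₁, G.Adj k i → G.Adj k j

theorem exists_coeff_of_mem_span [Fintype V] {E : Type*} [AddCommGroup E]
    [Module ℝ E] {X : V → E} {j : V} {x : E} (hx : x ∈ Submodule.span ℝ (X '' {k | G.Adj k j})) :
    ∃ w : V → ℝ, (∀ k, ¬ G.Adj k j → w k = 0) ∧ x = ∑ k, w k • X k := by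
  classical
  induction hx using Submodule.span_induction with
  | mem x hx =>
    obtain ⟨k, hk, rfl⟩ := hx
    refine ⟨Pi.single k 1, fun l hl => Pi.single_eq_of_ne (by rintro rfl; exact hl hk) _, ?_⟩
    simp [Pi.single_apply]
  | zero => exact ⟨0, fun _ _ => rfl, by simp⟩
  | add x y _ _ hx hy =>
    obtain ⟨w, hw, rfl⟩ := hx
    obtain ⟨w', hw', rfl⟩ := hy
    exact ⟨w + w', fun k hk => by simp [hw k hk, hw' k hk], by
      simp [add_smul, Finset.sum_add_distrib]⟩
  | smul a x _ hx =>
    obtain ⟨w, hw, rfl⟩ := hx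
    exact ⟨a • w, fun k hk => by simp [hw k hk], by simp [Finset.smul_sum, mul_smul]⟩

/-- Eliminating the vertices outside `V₁` keeps the parents but correlates the errors of the
vertices in `M`, those entered from outside. As `M` is a clique with nested parent sets, a
Gram–Schmidt process along its edges makes the errors orthogonal again without using new parents. -/
theorem IsMarginal.exists_realizes [Fintype V] {V₁ : Finset V} {G₁ : DAG V₁} {c : V}
    (hG : G.IsMarginal G₁ c) {E : Type*} [NormedAddCommGroup E] [InnerProductSpace ℝ E]
    {lam : V → V → ℝ} {X : V → E} (h : G.Realizes lam X) :
    ∃ lam₁ : V₁ → V₁ → ℝ, G₁.Realizes lam₁ (fun i : V₁ => X i) := by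
  classical
  set B : Set V := {v | v ∉ V₁} with hB
  set M : Set V := {j | j ∈ V₁ ∧ ∃ b, b ∉ V₁ ∧ G.Adj b j} with hM
  set N := G.errorSpan lam X with hN
  have hq : ∀ b, ∃ q : ℝ, b ∉ V₁ → (X b - q • X c ∈ N B ∧
      (¬ Relation.TransGen G.Adj c b → q = 0)) := fun b => by
    by_cases hb : b ∈ V₁
    · exact ⟨0, fun h => absurd hb h⟩
    · obtain ⟨q, h1, h2⟩ := exists_sub_smul_mem_errorSpan (lam := lam) (X := X) (S := B) (c := c)
        hG.entrance hb
      exact ⟨q, fun _ => ⟨h1, h2⟩⟩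
  choose q hq using hq
  set P : V → Submodule ℝ E := fun j => Submodule.span ℝ (X '' {k | k ∈ V₁ ∧ G.Adj k j}) with hP
  -- The error left at `j` once each outside parent `X b` is replaced by its multiple of `X c`.
  set u : V → E := fun j => G.residual lam X j +
    ∑ b ∈ V₁ᶜ, G.coeff lam b j • (X b - q b • X c) with hu
  have hu1 : ∀ j, u j - G.residual lam X j ∈ N B := by
    intro j
    simp only [hu, add_sub_cancel_left]
    exact sum_mem fun b hb => Submodule.smul_mem _ _ (hq b (by simpa using hb)).1
  have hu2 : ∀ j ∈ V₁, u j - X j ∈ P j := by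
    intro j hj
    have h1 : u j - X j = -(∑ k ∈ V₁, G.coeff lam k j • X k) -
        ∑ b ∈ V₁ᶜ, (G.coeff lam b j * q b) • X c := by
      simp only [hu, residual, smul_sub, Finset.sum_sub_distrib, mul_smul]
      rw [← Finset.sum_add_sum_compl V₁ fun k => G.coeff lam k j • X k]
      abel
    rw [h1]
    refine sub_mem (neg_mem (sum_mem fun k hk => ?_)) (sum_mem fun b hb => ?_)
    · by_cases hkj : G.Adj k j
      · exact Submodule.smul_mem _ _ (Submodule.subset_span ⟨k, ⟨hk, hkj⟩, rfl⟩)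
      · simp [coeff_of_not_adj hkj]
    · have hb : b ∉ V₁ := by simpa using hb
      by_cases hbj : G.Adj b j
      · rcases hG.exit_child b j hb hj hbj with rfl | hcj
        · rw [(hq b hb).2 fun hcb => G.acyclic _ (hcb.tail hbj)]
          simp
        · exact Submodule.smul_mem _ _ (Submodule.subset_span ⟨c, ⟨hG.mem, hcj⟩, rfl⟩)
      · simp [coeff_of_not_adj hbj]
  have hu3 : ∀ j ∈ V₁, j ∉ M → u j = G.residual lam X j := by
    intro j hj hjM
    simp only [hu, add_eq_left]
    refine Finset.sum_eq_zero fun b hb => ?_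
    rw [coeff_of_not_adj fun hbj => hjM ⟨hj, b, by simpa using hb, hbj⟩, zero_smul]
  set U : V → Submodule ℝ E := fun j =>
    Submodule.span ℝ (u '' {k | k ∈ M ∧ j ∈ M ∧ G.Adj k j}) with hU
  have : ∀ j, FiniteDimensional ℝ (U j) := fun j =>
    FiniteDimensional.span_of_finite ℝ (Set.toFinite _)
  have hUP : ∀ j, U j ≤ P j := by
    intro j
    refine Submodule.span_le.mpr ?_
    rintro _ ⟨k, ⟨⟨hk, a, ha, hak⟩, ⟨hj, b, hb, hbj⟩, hkj⟩, rfl⟩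
    -- Nestedness is what allows `u k` to be subtracted at `j`: it differs from `X k` only by
    -- parents of `k`, which are also parents of `j`.
    have hPP : P k ≤ P j := by
      refine Submodule.span_mono (Set.image_mono ?_)
      rintro l ⟨hl, hlk⟩
      exact ⟨hl, hG.nested a b k j ha hb hk hj hak hbj hkj l hl hlk⟩
    have := add_mem (hPP (hu2 k hk)) (Submodule.subset_span ⟨k, ⟨hk, hkj⟩, rfl⟩ : X k ∈ P j)
    simpa using this
  have huN : ∀ j, u j ∈ N (B ∪ {j}) := by
    intro j
    have h1 := errorSpan_mono (G := G) (lam := lam) (X := X)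
      (Set.subset_union_left (s := B) (t := {j})) (hu1 j)
    have h2 : G.residual lam X j ∈ N (B ∪ {j}) := residual_mem_errorSpan (by simp)
    simpa using add_mem h1 h2
  have hUN : ∀ j, U j ≤ N (B ∪ {k | k ∈ M ∧ G.Adj k j}) := by
    intro j
    refine Submodule.span_le.mpr ?_
    rintro _ ⟨k, ⟨hk, _, hkj⟩, rfl⟩
    refine errorSpan_mono (Set.union_subset_union_right _ ?_) (huN k)
    rintro _ rfl
    exact ⟨hk, hkj⟩
  -- Gram–Schmidt within `M`; outside `M` the space `U j` is zero and nothing changes.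
  set v : V → E := fun j => u j - (U j).starProjection (u j) with hv
  have hvU : ∀ j, v j - u j ∈ U j := by
    intro j
    simp only [hv, sub_sub_cancel_left]
    exact neg_mem (Submodule.starProjection_apply_mem _ _)
  have hvP : ∀ j ∈ V₁, X j - v j ∈ P j := by
    intro j hj
    have := neg_mem (add_mem (hUP j (hvU j)) (hu2 j hj))
    simpa using this
  have hvM : ∀ j ∈ V₁, j ∉ M → v j ∈ N {j} := by
    intro j hj hjM
    have h1 : U j = ⊥ := by
      rw [hU, Submodule.span_eq_bot]
      rintro _ ⟨k, ⟨_, h, _⟩, rfl⟩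
      exact absurd h hjM
    have h2 := hvU j
    rw [h1, Submodule.mem_bot, sub_eq_zero, hu3 j hj hjM] at h2
    rw [h2]
    exact residual_mem_errorSpan rfl
  have hvN : ∀ j ∈ M, v j ∈ N (B ∪ M) := by
    intro j hj
    have h1 := errorSpan_mono (G := G) (lam := lam) (X := X) (S := B ∪ {k | k ∈ M ∧ G.Adj k j})
      (T := B ∪ M) (Set.union_subset_union_right _ fun k hk => hk.1) (hUN j (hvU j))
    have h2 := errorSpan_mono (G := G) (lam := lam) (X := X) (S := B ∪ {j})
      (T := B ∪ M) (Set.union_subset_union_right _ (by simpa using hj)) (huN j)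
    simpa using add_mem h1 h2
  have hadj : ∀ i ∈ M, ∀ j ∈ M, G.Adj i j → ⟪v i, v j⟫_ℝ = 0 := by
    intro i hi j hj hij
    have h1 : v i ∈ U j := by
      have h2 : u i ∈ U j := Submodule.subset_span ⟨i, ⟨hi, hj, hij⟩, rfl⟩
      -- Acyclicity makes the edge relation on the clique `M` transitive, so predecessors of `i` are
      -- predecessors of `j`.
      have h3 : U i ≤ U j := by
        refine Submodule.span_mono (Set.image_mono ?_)
        rintro k ⟨hk, -, hki⟩
        refine ⟨hk, hj, ?_⟩
        have hkj : Relation.TransGen G.Adj k j := (Relation.TransGen.single hki).tail hij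
        obtain ⟨hk1, a, ha, hak⟩ := hk
        obtain ⟨hj1, b, hb, hbj⟩ := hj
        rcases hG.exit_clique a b k j ha hb hk1 hj1 hak hbj
          (fun h => G.acyclic k (by simpa [h] using hkj)) with h | h
        · exact h
        · exact absurd (hkj.tail h) (G.acyclic k)
      simpa using add_mem (h3 (hvU i)) h2
    exact Submodule.inner_right_of_mem_orthogonal h1
      (Submodule.sub_starProjection_mem_orthogonal (K := U j) (u j))
  have horth : ∀ i ∈ V₁, ∀ j ∈ V₁, i ≠ j → ⟪v i, v j⟫_ℝ = 0 := by
    intro i hi j hj hij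
    have key : ∀ i ∈ V₁, i ∉ M → Disjoint {i} (B ∪ M) := by
      intro i hi hiM
      rw [Set.disjoint_singleton_left]
      rintro (h | h)
      · exact h hi
      · exact hiM h
    by_cases hiM : i ∈ M <;> by_cases hjM : j ∈ M
    · obtain ⟨_, a, ha, hai⟩ := id hiM
      obtain ⟨_, b, hb, hbj⟩ := id hjM
      rcases hG.exit_clique a b i j ha hb hi hj hai hbj hij with h | h
      · exact hadj i hiM j hjM h
      · rw [real_inner_comm]
        exact hadj j hjM i hiM h
    · exact h.inner_eq_zero (key j hj hjM).symm (hvN i hiM) (hvM j hj hjM)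
    · exact h.inner_eq_zero (key i hi hiM) (hvM i hi hiM) (hvN j hjM)
    · exact h.inner_eq_zero (by simpa using hij) (hvM i hi hiM) (hvM j hj hjM)
  have hne : ∀ j ∈ V₁, v j ≠ 0 := by
    intro j hj h0
    -- The corrections involve only errors of other vertices, so the original error of `j` survives
    -- in `v j`.
    have h1 : v j - G.residual lam X j ∈ N (B ∪ {k | k ∈ M ∧ G.Adj k j}) := by
      have := add_mem (hUN j (hvU j)) (errorSpan_mono (G := G) (lam := lam) (X := X)
        (Set.subset_union_left (t := {k | k ∈ M ∧ G.Adj k j})) (hu1 j))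
      simpa using this
    have h2 := h.inner_eq_zero (S := B ∪ {k | k ∈ M ∧ G.Adj k j}) (T := {j}) (by
      rw [Set.disjoint_singleton_right]
      rintro (h | h)
      · exact h hj
      · exact G.acyclic j (.single h.2)) h1 (residual_mem_errorSpan (v := j) rfl)
    rw [h0, zero_sub, inner_neg_left, neg_eq_zero, inner_self_eq_zero] at h2
    exact h.ne_zero j h2
  have hw : ∀ j : V₁, ∃ w : V₁ → ℝ, (∀ k, ¬ G₁.Adj k j → w k = 0) ∧
      X j - v j = ∑ k, w k • X k := by
    intro j
    refine exists_coeff_of_mem_span (G := G₁) (X := fun i : V₁ => X i) (j := j) ?_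
    have h1 := hvP j j.2
    have h2 : X '' {k | k ∈ V₁ ∧ G.Adj k j} = (fun i : V₁ => X i) '' {k | G₁.Adj k j} := by
      ext x
      constructor
      · rintro ⟨k, ⟨hk, hkj⟩, rfl⟩
        exact ⟨⟨k, hk⟩, (hG.adj_iff _ _).mpr hkj, rfl⟩
      · rintro ⟨k, hk, rfl⟩
        exact ⟨k, ⟨k.2, (hG.adj_iff _ _).mp hk⟩, rfl⟩
    rwa [← h2]
  choose w hw0 hw using hw
  have hres : ∀ j : V₁, G₁.residual (fun k j => w j k) (fun i : V₁ => X i) j = v j := by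
    intro j
    rw [residual, sub_eq_iff_eq_add, ← sub_eq_iff_eq_add', hw]
    exact Finset.sum_congr rfl fun k _ => by
      rw [coeff_eq_self fun i j hij => hw0 j i hij]
  refine ⟨fun k j => w j k, fun j => ?_, fun i j hij => ?_⟩
  · rw [hres]
    exact hne j j.2
  · rw [hres, hres]
    exact horth i i.2 j j.2 fun h => hij (Subtype.ext h)

/-- A polynomial that vanishes on the model of `G₁` vanishes on the model of `G`. -/
theorem IsMarginal.rename_mem [Fintype V] {V₁ : Finset V} {G₁ : DAG V₁} {c : V}
    (hG : G.IsMarginal G₁ c) {f : MvPolynomial (Sym2 V₁) ℂ} (hf : f ∈ G₁.vanishingIdeal) :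
    MvPolynomial.rename (Sym2.map Subtype.val) f ∈ G.vanishingIdeal := by
  rw [vanishingIdeal, MvPolynomial.mem_vanishingIdeal_iff] at hf ⊢
  intro p hp
  rw [MvPolynomial.aeval_rename]
  obtain ⟨lam, X, hX, hpX⟩ := exists_realizes_of_mem_model hp
  obtain ⟨lam₁, h₁⟩ := hG.exists_realizes hX
  exact hf _ (h₁.mem_model fun i j => by simp [hpX])

end DAG

namespace DAG

/-! ### Reduction to the indeterminates of vertices and edges -/

section Coordinates

variable {V : Type*} (G : DAG V)

/-- The two end points of a parameter: `(v, v)` for a vertex and `(k, l)` for an edge `k → l`. -/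
def ends : V ⊕ G.Edge → V × V :=
  Sum.elim (fun v => (v, v)) (fun e => e.1)

/-- The indeterminate `σ_{vv}` of a vertex `v` and `σ_{kl}` of an edge `k → l`. -/
def coord (x : V ⊕ G.Edge) : Sym2 V :=
  s((G.ends x).1, (G.ends x).2)

/-- The products of diagonal indeterminates `σ_{vv}`. -/
noncomputable def diagMonomials (V : Type*) : Submonoid (MvPolynomial (Sym2 V) ℂ) :=
  Submonoid.closure (Set.range fun v : V => MvPolynomial.X s(v, v))

/-- Modulo `I`, a multiple of `f` by a product of diagonal indeterminates is a polynomial in the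
indeterminates of vertices and edges. -/
def Reduces (I : Ideal (MvPolynomial (Sym2 V) ℂ)) (f : MvPolynomial (Sym2 V) ℂ) : Prop :=
  ∃ m ∈ diagMonomials V, ∃ h, m * f - MvPolynomial.rename G.coord h ∈ I

variable {G} {I : Ideal (MvPolynomial (Sym2 V) ℂ)} {f g : MvPolynomial (Sym2 V) ℂ}

theorem X_mem_diagMonomials (v : V) : MvPolynomial.X s(v, v) ∈ diagMonomials V :=
  Submonoid.subset_closure ⟨v, rfl⟩

theorem exists_rename_eq_of_mem_diagMonomials {m : MvPolynomial (Sym2 V) ℂ}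
    (hm : m ∈ diagMonomials V) : ∃ h, MvPolynomial.rename G.coord h = m := by
  have : diagMonomials V ≤ (MvPolynomial.rename (R := ℂ) G.coord).range.toSubmonoid := by
    refine Submonoid.closure_le.mpr ?_
    rintro _ ⟨v, rfl⟩
    exact ⟨MvPolynomial.X (Sum.inl v), by simp [coord, ends]⟩
  exact this hm

theorem reduces_rename (h : MvPolynomial (V ⊕ G.Edge) ℂ) :
    G.Reduces I (MvPolynomial.rename G.coord h) :=
  ⟨1, one_mem _, h, by simp⟩

theorem reduces_of_mem (h : f ∈ I) : G.Reduces I f :=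
  ⟨1, one_mem _, 0, by simpa⟩

/-- A common denominator works because the diagonal indeterminates are themselves among the
coordinates. -/
theorem Reduces.add (hf : G.Reduces I f) (hg : G.Reduces I g) : G.Reduces I (f + g) := by
  obtain ⟨m, hm, h, hf⟩ := hf
  obtain ⟨m', hm', h', hg⟩ := hg
  obtain ⟨n, rfl⟩ := exists_rename_eq_of_mem_diagMonomials (G := G) hm
  obtain ⟨n', rfl⟩ := exists_rename_eq_of_mem_diagMonomials (G := G) hm'
  refine ⟨_, mul_mem hm hm', n' * h + n * h', ?_⟩
  convert add_mem (I.mul_mem_left (MvPolynomial.rename G.coord n') hf)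
    (I.mul_mem_left (MvPolynomial.rename G.coord n) hg) using 1
  simp only [map_add, map_mul]
  ring

theorem Reduces.mul (hf : G.Reduces I f) (hg : G.Reduces I g) : G.Reduces I (f * g) := by
  obtain ⟨m, hm, h, hf⟩ := hf
  obtain ⟨m', hm', h', hg⟩ := hg
  refine ⟨_, mul_mem hm hm', h * h', ?_⟩
  convert add_mem (I.mul_mem_left (m' * g) hf)
    (I.mul_mem_left (MvPolynomial.rename G.coord h) hg) using 1
  simp only [map_mul]
  ring

theorem Reduces.of_mul_sub_mem {m : MvPolynomial (Sym2 V) ℂ} (hm : m ∈ diagMonomials V)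
    (hg : G.Reduces I g) (h : m * f - g ∈ I) : G.Reduces I f := by
  obtain ⟨m', hm', h', hg⟩ := hg
  refine ⟨_, mul_mem hm' hm, h', ?_⟩
  convert add_mem (I.mul_mem_left m' h) hg using 1
  ring

theorem reduces_of_forall_X (h : ∀ s, G.Reduces I (MvPolynomial.X s))
    (f : MvPolynomial (Sym2 V) ℂ) : G.Reduces I f := by
  induction f using MvPolynomial.induction_on with
  | C a => simpa using reduces_rename (G := G) (I := I) (MvPolynomial.C a)
  | add f g hf hg => exact hf.add hg
  | mul_X f s hf => exact hf.mul (h s)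

end Coordinates

/-! ### The shortest trek ideal in these coordinates -/

section ShortestTrekIdeal

variable {V : Type*} {G : DAG V}

/-- The trek without edges. -/
def Trek.refl (G : DAG V) (v : V) : G.Trek v v :=
  ⟨v, [], [], .singleton _, .singleton _, rfl, rfl, by simp⟩

theorem Trek.refl_isShortest (v : V) : (Trek.refl G v).IsShortest := fun _ => Nat.zero_le _

theorem Trek.eq_of_length_eq_zero {i j : V} (P : G.Trek i j) (h : P.length = 0) : i = j := by
  obtain ⟨t, l, r, _, _, rfl, rfl, _⟩ := P
  simp only [Trek.length, Nat.add_eq_zero_iff, List.length_eq_zero_iff] at h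
  obtain ⟨rfl, rfl⟩ := h
  rfl

theorem ne_of_adj {i j : V} (h : G.Adj i j) : i ≠ j := by
  rintro rfl
  exact G.acyclic _ (.single h)

/-- The trek that consists of one edge. -/
def Trek.single {i j : V} (h : G.Adj i j) : G.Trek i j :=
  ⟨i, [], [j], .singleton _, by simpa using h, rfl, rfl, by simpa using ne_of_adj h⟩

theorem Trek.single_isShortest {i j : V} (h : G.Adj i j) : (Trek.single h).IsShortest := by
  intro Q
  by_contra! hQ
  exact ne_of_adj h (Q.eq_of_length_eq_zero (by simpa [Trek.length, Trek.single] using hQ))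

variable [Fintype V]

theorem shortestTrekMap_coord_inl (hG : G.HasUniqueShortestTreks) (v : V) :
    G.shortestTrekMap (MvPolynomial.X (G.coord (Sum.inl v))) = MvPolynomial.X (Sum.inl v) := by
  refine (shortestTrekMap_X hG _ (Trek.refl_isShortest v)).trans ?_
  simp [Trek.monomial, Trek.refl, Trek.edges]

theorem shortestTrekMap_coord_inr (hG : G.HasUniqueShortestTreks) (e : G.Edge) :
    G.shortestTrekMap (MvPolynomial.X (G.coord (Sum.inr e))) =
      MvPolynomial.X (Sum.inl e.1.1) * MvPolynomial.X (Sum.inr e) := by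
  classical
  refine (shortestTrekMap_X hG _ (Trek.single_isShortest e.2)).trans ?_
  have : ∀ e' : G.Edge, (e'.1 = (e.1.1, e.1.2)) ↔ e' = e := fun e' => Subtype.ext_iff.symm
  simp [Trek.monomial, Trek.single, Trek.edges, this]

theorem shortestTrekMap_ne_zero (hG : G.HasUniqueShortestTreks)
    {m : MvPolynomial (Sym2 V) ℂ} (hm : m ∈ diagMonomials V) : G.shortestTrekMap m ≠ 0 := by
  have : diagMonomials V ≤ (nonZeroDivisors (MvPolynomial (V ⊕ G.Edge) ℂ)).comap
      G.shortestTrekMap := by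
    refine Submonoid.closure_le.mpr ?_
    rintro _ ⟨v, rfl⟩
    have := shortestTrekMap_coord_inl hG v
    simp only [coord, ends, Sum.elim_inl] at this
    simp [this]
  exact nonZeroDivisors.ne_zero (this hm)

theorem eq_zero_of_rename_mem_shortestTrekIdeal (hG : G.HasUniqueShortestTreks)
    {h : MvPolynomial (V ⊕ G.Edge) ℂ}
    (hh : MvPolynomial.rename G.coord h ∈ G.shortestTrekIdeal) : h = 0 := by
  refine MvPolynomial.funext_set (fun _ => {z : ℂ | z ≠ 0})
    (fun _ => (Set.finite_singleton (0 : ℂ)).infinite_compl) fun z hz => ?_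
  have hz' : ∀ x, z x ≠ 0 := fun x => hz x trivial
  -- At a point with nonzero entries, substituting z_kl / z_k for λ_kl undoes the map σ_kl ↦ a_k
  -- λ_kl.
  have h1 : MvPolynomial.aeval (Sum.elim (fun v => z (Sum.inl v))
      fun e : G.Edge => z (Sum.inr e) / z (Sum.inl e.1.1)) (G.shortestTrekMap
        (MvPolynomial.rename G.coord h)) = (0 : ℂ) := by
    rw [show G.shortestTrekMap (MvPolynomial.rename G.coord h) = 0 from hh, map_zero]
  rw [map_zero, ← h1, ← MvPolynomial.coe_aeval_eq_eval, RingHom.coe_coe, ← AlgHom.comp_apply,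
    ← AlgHom.comp_apply]
  congr 1
  ext x
  rcases x with v | e
  · simp [shortestTrekMap_coord_inl hG]
  · simp [shortestTrekMap_coord_inr hG, mul_div_cancel₀ _ (hz' (Sum.inl e.1.1))]

/-- Multiplying by σ_kk for each edge k → l of the shortest trek supplies the factors a_k that turn
its λ_kl into images of σ_kl; the top contributes its own diagonal indeterminate. -/
theorem reduces_X_shortestTrekIdeal (hG : G.HasUniqueShortestTreks) (s : Sym2 V) :
    G.Reduces G.shortestTrekIdeal (MvPolynomial.X s) := by
  classical
  induction s with
  | _ i j =>
  by_cases hP : Nonempty (G.Trek i j)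
  · obtain ⟨P, hP, -⟩ := hG i j hP
    refine ⟨∏ e : G.Edge, if e.1 ∈ P.edges then MvPolynomial.X s(e.1.1, e.1.1) else 1,
      prod_mem fun e _ => ?_, MvPolynomial.X (Sum.inl P.top) *
        ∏ e : G.Edge, if e.1 ∈ P.edges then MvPolynomial.X (Sum.inr e) else 1, ?_⟩
    · split_ifs
      · exact X_mem_diagMonomials _
      · exact one_mem _
    · have h1 : ∀ v, G.shortestTrekMap (MvPolynomial.X s(v, v)) = MvPolynomial.X (Sum.inl v) :=
        shortestTrekMap_coord_inl hG
      rw [shortestTrekIdeal, RingHom.mem_ker]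
      simp only [map_sub, map_mul, map_prod, apply_ite, map_one, MvPolynomial.rename_X,
        shortestTrekMap_coord_inl hG, shortestTrekMap_coord_inr hG, shortestTrekMap_X hG P hP, h1]
      rw [Trek.monomial, mul_left_comm, ← mul_sub, ← Finset.prod_mul_distrib, sub_eq_zero.mpr,
        mul_zero]
      exact Finset.prod_congr rfl fun e _ => by split_ifs <;> simp
  · refine reduces_of_mem ?_
    rw [not_nonempty_iff] at hP
    exact shortestTrekMap_X_of_isEmpty hP

/-- The shortest trek ideal is toric. -/
theorem isToricIdeal_shortestTrekIdeal : IsToricIdeal G.shortestTrekIdeal := by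
  classical
  let N := Fintype.card (V ⊕ G.Edge)
  let e : V ⊕ G.Edge ≃ Fin N := Fintype.equivFin _
  let φ : (V ⊕ G.Edge →₀ ℕ) →+ (Fin N → ℤ) :=
    { toFun := fun a k => (a (e.symm k) : ℤ)
      map_zero' := by ext; simp
      map_add' := fun a b => by ext; simp }
  have hφ : Function.Injective φ := by
    intro a b hab
    ext x
    have := congrFun hab (e x)
    simpa [φ] using this
  -- The inclusion of polynomials into Laurent polynomials; being injective, it does not change the
  -- kernel.
  let ι : MvPolynomial (V ⊕ G.Edge) ℂ →ₐ[ℂ] AddMonoidAlgebra ℂ (Fin N → ℤ) :=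
    AddMonoidAlgebra.mapDomainAlgHom ℂ ℂ φ
  have hι : Function.Injective ι := AddMonoidAlgebra.mapDomain_injective hφ
  have hmon : ∀ p ∈ Submonoid.closure
      (Set.range (MvPolynomial.X : V ⊕ G.Edge → MvPolynomial (V ⊕ G.Edge) ℂ)),
      ∃ a, p = MvPolynomial.monomial a 1 := by
    intro p hp
    induction hp using Submonoid.closure_induction with
    | mem p hp =>
      obtain ⟨x, rfl⟩ := hp
      exact ⟨_, rfl⟩
    | one => exact ⟨0, rfl⟩
    | mul p q _ _ hp hq =>
      obtain ⟨a, rfl⟩ := hp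
      obtain ⟨b, rfl⟩ := hq
      exact ⟨a + b, by simp [MvPolynomial.monomial_mul]⟩
  refine ⟨N, ι.comp G.shortestTrekMap, fun s => ?_, ?_⟩
  · rw [AlgHom.comp_apply, shortestTrekMap, MvPolynomial.aeval_X, shortestTrekMonomial]
    split_ifs with h
    · right
      obtain ⟨a, ha⟩ := hmon h.choose.2.2.monomial (by
        rw [Trek.monomial]
        refine mul_mem (Submonoid.subset_closure ⟨_, rfl⟩) (prod_mem fun e _ => ?_)
        split_ifs
        · exact Submonoid.subset_closure ⟨_, rfl⟩
        · exact one_mem _)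
      refine ⟨φ a, ?_⟩
      rw [ha]
      exact AddMonoidAlgebra.mapDomain_single
    · left
      exact map_zero ι
  · ext f
    rw [RingHom.mem_ker, AlgHom.comp_apply, map_eq_zero_iff ι hι, shortestTrekIdeal,
      RingHom.mem_ker]

end ShortestTrekIdeal

end DAG

/-! ### The vanishing ideal in these coordinates -/

namespace DAG

open Filter Topology

variable {V : Type*} {G : DAG V}

/-- The regression coefficients with given values on the edges. -/
noncomputable def edgeCoeff (θ : V ⊕ G.Edge → ℝ) (k l : V) : ℝ :=
  open Classical in if h : G.Adj k l then θ (Sum.inr ⟨(k, l), h⟩) else 0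

theorem coeff_edgeCoeff (θ : V ⊕ G.Edge → ℝ) (k l : V) :
    G.coeff (edgeCoeff θ) k l = edgeCoeff θ k l :=
  coeff_eq_self (fun i j hij => by simp [edgeCoeff, hij]) k l

/-- The parameters with error variances `1` and without regression. -/
noncomputable def baseParam : V ⊕ G.Edge → ℝ := Sum.elim (fun _ => 1) (fun _ => 0)

open Classical in
/-- The derivative of the coefficient of the pair `(k, l)`. -/
noncomputable def edgeDeriv (k l : V) : (V ⊕ G.Edge → ℝ) →L[ℝ] ℝ :=
  if h : G.Adj k l then ContinuousLinearMap.proj (R := ℝ) (φ := fun _ => ℝ) (Sum.inr ⟨(k, l), h⟩)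
  else 0

theorem edgeCoeff_baseParam (k l : V) : edgeCoeff (G := G) baseParam k l = 0 := by
  simp [edgeCoeff, baseParam]

theorem edgeDeriv_of_not_adj {k l : V} (h : ¬ G.Adj k l) : edgeDeriv (G := G) k l = 0 := by
  simp [edgeDeriv, h]

theorem hasStrictFDerivAt_edgeCoeff (k l : V) :
    HasStrictFDerivAt (fun θ : V ⊕ G.Edge → ℝ => edgeCoeff θ k l) (edgeDeriv k l) baseParam := by
  by_cases h : G.Adj k l
  · simp only [edgeCoeff, edgeDeriv, h, dif_pos]
    exact (ContinuousLinearMap.proj (R := ℝ) (φ := fun _ => ℝ)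
      (Sum.inr ⟨(k, l), h⟩ : V ⊕ G.Edge)).hasStrictFDerivAt
  · simp only [edgeCoeff, edgeDeriv, h, dif_neg, not_false_iff]
    exact hasStrictFDerivAt_const _ _

variable [Fintype V]

/-- The covariances of the vertices and edges as a function of the parameters. -/
noncomputable def coordMap (θ : V ⊕ G.Edge → ℝ) (x : V ⊕ G.Edge) : ℝ :=
  G.covariance (edgeCoeff θ) (fun v => θ (Sum.inl v)) (G.ends x).1 (G.ends x).2

theorem inv_baseParam [DecidableEq V] :
    (1 - G.coeff (edgeCoeff (G := G) baseParam))⁻¹ = 1 := by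
  have : G.coeff (edgeCoeff (G := G) baseParam) = 0 := by
    ext i j
    rw [coeff_edgeCoeff, edgeCoeff_baseParam, Matrix.zero_apply]
  rw [this, sub_zero, inv_one]

theorem hasStrictFDerivAt_inv [DecidableEq V] (v j : V) :
    HasStrictFDerivAt (fun θ : V ⊕ G.Edge → ℝ => (1 - G.coeff (edgeCoeff θ))⁻¹ v j)
      (edgeDeriv v j) baseParam := by
  classical
  induction j using G.wellFounded_adj.induction with
  | _ j ih =>
    -- From N(1 − L) = 1: column `j` of the inverse is expressed by the columns of the parents,
    -- which permits induction. At the base point L = 0 and N = 1, so only the term `k = v` has a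
    -- derivative.
    have h1 : (fun θ : V ⊕ G.Edge → ℝ => (1 - G.coeff (edgeCoeff θ))⁻¹ v j) = fun θ =>
        (1 : Matrix V V ℝ) v j + ∑ k, (1 - G.coeff (edgeCoeff θ))⁻¹ v k * edgeCoeff θ k j := by
      ext θ
      have h := congrFun (congrFun (Matrix.nonsing_inv_mul (1 - G.coeff (edgeCoeff θ))
        ((Matrix.isUnit_iff_isUnit_det _).mp (G.isUnit_one_sub_coeff _))) v) j
      rw [mul_sub, mul_one, Matrix.sub_apply, Matrix.mul_apply] at h
      simp only [coeff_edgeCoeff] at h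
      linarith
    rw [h1]
    have h2 : ∀ k ∈ Finset.univ, HasStrictFDerivAt
        (fun θ : V ⊕ G.Edge → ℝ => (1 - G.coeff (edgeCoeff θ))⁻¹ v k * edgeCoeff θ k j)
        ((1 : Matrix V V ℝ) v k • edgeDeriv k j) baseParam := by
      intro k _
      by_cases hk : G.Adj k j
      · refine ((ih k hk).mul (hasStrictFDerivAt_edgeCoeff k j)).congr_fderiv ?_
        rw [inv_baseParam, edgeCoeff_baseParam, zero_smul, add_zero]
      · have : (fun θ : V ⊕ G.Edge → ℝ => (1 - G.coeff (edgeCoeff θ))⁻¹ v k * edgeCoeff θ k j) =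
            fun _ => 0 := by
          ext θ
          simp [edgeCoeff, hk]
        rw [this, edgeDeriv_of_not_adj hk, smul_zero]
        exact hasStrictFDerivAt_const _ _
    refine ((HasStrictFDerivAt.fun_sum h2).const_add _).congr_fderiv ?_
    simp [Matrix.one_apply]

/-- At L = 0 and Ω = 1 the covariance has derivative dΩ + dL + dLᵀ. Since k → l excludes l → k, this
is dλ_kl at an edge, and it is dω_v on the diagonal. -/
theorem hasStrictFDerivAt_coordMap :
    HasStrictFDerivAt (coordMap (G := G))
      (ContinuousLinearEquiv.refl ℝ (V ⊕ G.Edge → ℝ) : _ →L[ℝ] _) baseParam := by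
  classical
  rw [hasStrictFDerivAt_pi']
  intro x
  have hom : ∀ v : V, HasStrictFDerivAt (fun θ : V ⊕ G.Edge → ℝ => θ (Sum.inl v))
      (ContinuousLinearMap.proj (R := ℝ) (φ := fun _ => ℝ) (Sum.inl v)) baseParam := fun v =>
    (ContinuousLinearMap.proj (R := ℝ) (φ := fun _ => ℝ)
      (Sum.inl v : V ⊕ G.Edge)).hasStrictFDerivAt
  have h := HasStrictFDerivAt.fun_sum (u := Finset.univ) fun v _ =>
    ((hom v).mul (hasStrictFDerivAt_inv v (G.ends x).1)).mul
      (hasStrictFDerivAt_inv v (G.ends x).2)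
  have h1 : (fun θ : V ⊕ G.Edge → ℝ => coordMap θ x) = fun θ => ∑ v, θ (Sum.inl v) *
      (1 - G.coeff (edgeCoeff θ))⁻¹ v (G.ends x).1 *
      (1 - G.coeff (edgeCoeff θ))⁻¹ v (G.ends x).2 := by
    ext θ
    rw [coordMap, covariance_apply]
  rw [h1]
  refine h.congr_fderiv ?_
  have hbase : ∀ v : V, baseParam (G := G) (Sum.inl v) = 1 := fun _ => rfl
  simp only [Pi.mul_apply, inv_baseParam, hbase, Matrix.one_apply, one_mul, ite_smul, one_smul,
    zero_smul, Finset.sum_add_distrib, Finset.sum_ite_eq', Finset.mem_univ, if_true]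
  rcases x with v | ⟨⟨k, l⟩, hkl⟩
  · have h0 : edgeDeriv (G := G) v v = 0 := edgeDeriv_of_not_adj fun h => G.acyclic v (.single h)
    ext θ
    simp [ends, h0]
  · have h0 : edgeDeriv (G := G) l k = 0 :=
      edgeDeriv_of_not_adj fun h => G.acyclic k ((Relation.TransGen.single hkl).tail h)
    have h3 : k ≠ l := ne_of_adj hkl
    have h2 : edgeDeriv (G := G) k l = ContinuousLinearMap.proj (R := ℝ) (φ := fun _ => ℝ)
      (Sum.inr ⟨(k, l), hkl⟩) := dif_pos hkl
    ext θ
    simp [ends, h0, h2, h3.symm]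

/-- By the inverse function theorem the coordinates of model points fill a real box, and a complex
polynomial that vanishes on a product of infinite sets is zero. -/
theorem eq_zero_of_rename_mem_vanishingIdeal {h : MvPolynomial (V ⊕ G.Edge) ℂ}
    (hh : MvPolynomial.rename G.coord h ∈ G.vanishingIdeal) : h = 0 := by
  classical
  have hmap := (hasStrictFDerivAt_coordMap (G := G)).map_nhds_eq_of_equiv
  have hpos : {θ : V ⊕ G.Edge → ℝ | ∀ v, 0 < θ (Sum.inl v)} ∈ 𝓝 (baseParam (G := G)) := by
    refine IsOpen.mem_nhds ?_ fun v => by simp [baseParam]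
    simp only [Set.ofPred_forall]
    exact isOpen_iInter_of_finite fun v => isOpen_lt continuous_const (continuous_apply _)
  have himg := image_mem_map (m := coordMap) hpos
  rw [hmap, Metric.mem_nhds_iff] at himg
  obtain ⟨ε, hε, hball⟩ := himg
  set y := coordMap (G := G) baseParam
  refine MvPolynomial.funext_set (fun x => Complex.ofReal '' Metric.ball (y x) ε)
    (fun x => Set.Infinite.image Complex.ofReal_injective.injOn ?_) fun z hz => ?_
  · rw [Real.ball_eq_Ioo]
    exact Set.Ioo_infinite (by linarith)
  choose r hr hrz using fun x => hz x trivial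
  obtain ⟨θ, hθ, hθr⟩ := hball (show r ∈ Metric.ball y ε by
    rw [Metric.mem_ball, dist_pi_lt_iff hε]
    exact hr)
  rw [vanishingIdeal, MvPolynomial.mem_vanishingIdeal_iff] at hh
  have hp : (fun s : Sym2 V => s.lift ⟨fun i j =>
      ((G.covariance (edgeCoeff θ) (fun v => θ (Sum.inl v)) i j : ℝ) : ℂ), fun i j => by
        classical
        simp only [covariance_apply]
        congr 1
        exact Finset.sum_congr rfl fun v _ => by ring⟩) ∈ G.model :=
    ⟨edgeCoeff θ, fun v => θ (Sum.inl v), hθ, fun i j => rfl⟩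
  have := hh _ hp
  rw [MvPolynomial.aeval_rename] at this
  rw [map_zero, ← this, ← MvPolynomial.coe_aeval_eq_eval, RingHom.coe_coe]
  congr 2
  ext x
  rw [← hrz, ← hθr]
  rfl

theorem aeval_ne_zero_of_mem_diagMonomials {p : Sym2 V → ℂ} (hp : p ∈ G.model)
    {m : MvPolynomial (Sym2 V) ℂ} (hm : m ∈ diagMonomials V) : MvPolynomial.aeval p m ≠ 0 := by
  obtain ⟨lam, X, hX, hpX⟩ := exists_realizes_of_mem_model hp
  have : diagMonomials V ≤ (nonZeroDivisors ℂ).comap (MvPolynomial.aeval p) := by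
    refine Submonoid.closure_le.mpr ?_
    rintro _ ⟨v, rfl⟩
    have h1 : X v - G.residual lam X v ∈
        G.errorSpan lam X {u | Relation.TransGen G.Adj u v} := by
      rw [residual, sub_sub_cancel]
      refine sum_mem fun k _ => ?_
      by_cases hk : G.Adj k v
      · exact Submodule.smul_mem _ _ (mem_errorSpan
          (fun u w huw hw => Relation.TransGen.head huw hw) (.single hk))
      · simp [coeff_of_not_adj hk]
    have h2 := hX.inner_eq_zero (T := {v}) (by simpa using G.acyclic v) h1
      (residual_mem_errorSpan rfl)
    have h3 : X v ≠ 0 := fun h0 => by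
      rw [h0, zero_sub, inner_neg_left, neg_eq_zero, inner_self_eq_zero] at h2
      exact hX.ne_zero v h2
    simpa [hpX] using h3
  exact nonZeroDivisors.ne_zero (this hm)

/-- If every indeterminate is, up to diagonal indeterminates, a polynomial in the indeterminates of
vertices and edges modulo both ideals, then the two ideals agree. -/
theorem vanishingIdeal_eq_shortestTrekIdeal (hG : G.HasUniqueShortestTreks)
    (h : ∀ s, G.Reduces (G.vanishingIdeal ⊓ G.shortestTrekIdeal) (MvPolynomial.X s)) :
    G.vanishingIdeal = G.shortestTrekIdeal := by
  ext f
  obtain ⟨m, hm, g, hI, hS⟩ := reduces_of_forall_X h f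
  constructor
  · intro hf
    -- The reduced form of `f` lies in the ideal too, hence is zero; so `m * f` is in the other
    -- ideal, where `m` can be cancelled.
    obtain rfl := eq_zero_of_rename_mem_vanishingIdeal
      (by simpa using sub_mem (Ideal.mul_mem_left _ m hf) hI)
    rw [map_zero, sub_zero] at hS
    have h1 : G.shortestTrekMap m * G.shortestTrekMap f = 0 := by
      rw [← map_mul]
      exact hS
    exact (mul_eq_zero.mp h1).resolve_left (shortestTrekMap_ne_zero hG hm)
  · intro hf
    obtain rfl := eq_zero_of_rename_mem_shortestTrekIdeal hG
      (by simpa using sub_mem (Ideal.mul_mem_left _ m hf) hS)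
    replace hI : m * f ∈ G.vanishingIdeal := by simpa using hI
    rw [vanishingIdeal, MvPolynomial.mem_vanishingIdeal_iff] at hI
    rw [vanishingIdeal, MvPolynomial.mem_vanishingIdeal_iff]
    intro p hp
    have h1 := hI p hp
    rw [map_mul] at h1
    exact (mul_eq_zero.mp h1).resolve_left (aeval_ne_zero_of_mem_diagMonomials hp hm)

end DAG

/-! ### Shortest treks in a marginal -/

namespace DAG

variable {V : Type*} {G : DAG V}

theorem Trek.existsUnique_isShortest_symm {i j : V}
    (h : Nonempty (G.Trek i j) → ∃! P : G.Trek i j, P.IsShortest) :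
    Nonempty (G.Trek j i) → ∃! P : G.Trek j i, P.IsShortest := by
  rintro ⟨Q⟩
  obtain ⟨P, hP, hu⟩ := h ⟨Q.symm⟩
  refine ⟨P.symm, hP.symm, fun R hR => ?_⟩
  rw [← hu R.symm hR.symm]
  rfl

section Contraction

variable {V₁ : Finset V} {G₁ : DAG V₁} {c : V}

/-- A path leaves `V₁` only from `c` and returns to a child of `c`, so each excursion is replaced by
one edge. A path that starts outside is cut down to start at its first vertex `z` in `V₁`. -/
theorem IsMarginal.exists_contracted_path (hG : G.IsMarginal G₁ c) (l : List V) :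
    ∀ x, (x :: l).IsChain G.Adj → (x :: l).getLast (List.cons_ne_nil _ _) ∈ V₁ →
    ∃ l', l'.Sublist l ∧ (∀ v ∈ l', v ∈ V₁) ∧
      (x ∈ V₁ → (x :: l').IsChain G.Adj ∧ (x :: l').getLast (List.cons_ne_nil _ _) =
        (x :: l).getLast (List.cons_ne_nil _ _)) ∧
      (x ∉ V₁ → ∃ z t, l' = z :: t ∧ (∃ b, b ∉ V₁ ∧ G.Adj b z) ∧ Relation.TransGen G.Adj x z ∧
        (z :: t).IsChain G.Adj ∧ (z :: t).getLast (List.cons_ne_nil _ _) =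
          (x :: l).getLast (List.cons_ne_nil _ _)) := by
  induction l with
  | nil =>
    intro x _ hx
    exact ⟨[], .slnil, by simp, fun _ => ⟨.singleton _, rfl⟩, fun h => absurd hx h⟩
  | cons y l ih =>
    intro x hx hlast
    rw [List.isChain_cons_cons] at hx
    rw [List.getLast_cons_cons] at hlast
    obtain ⟨l', hsub, hV, h1, h2⟩ := ih y hx.2 hlast
    by_cases hy : y ∈ V₁
    · obtain ⟨hc, hl⟩ := h1 hy
      refine ⟨y :: l', hsub.cons_cons y, by simpa [hy] using hV, fun _ => ⟨?_, ?_⟩, fun hxV => ?_⟩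
      · exact List.isChain_cons_cons.mpr ⟨hx.1, hc⟩
      · rw [List.getLast_cons_cons, List.getLast_cons_cons, hl]
      · exact ⟨y, l', rfl, ⟨x, hxV, hx.1⟩, .single hx.1, hc, by rw [hl, List.getLast_cons_cons]⟩
    · obtain ⟨z, t, rfl, ⟨b, hb, hbz⟩, hyz, hc, hl⟩ := h2 hy
      have hxz := hyz.head hx.1
      refine ⟨z :: t, hsub.cons y, hV, fun hxV => ?_, fun hxV => ?_⟩
      · obtain rfl := (hG.entrance x y hx.1 hy).resolve_left (not_not.mpr hxV)
        rcases hG.exit_child b z hb (hV z (by simp)) hbz with rfl | h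
        · exact absurd hxz (G.acyclic _)
        · exact ⟨List.isChain_cons_cons.mpr ⟨h, hc⟩, by
            rw [List.getLast_cons_cons, List.getLast_cons_cons, hl]⟩
      · exact ⟨z, t, rfl, ⟨b, hb, hbz⟩, hxz, hc, by rw [hl, List.getLast_cons_cons]⟩

theorem IsMarginal.exists_contracted_trek (hG : G.IsMarginal G₁ c) {i j : V} (hi : i ∈ V₁)
    (hj : j ∈ V₁) (P : G.Trek i j) :
    ∃ Q : G.Trek i j, (∀ v ∈ Q.support, v ∈ V₁) ∧ (Q = P ∨ Q.length < P.length) := by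
  obtain ⟨l, hls, hlV, hl1, hl2⟩ := hG.exists_contracted_path P.left P.top P.left_chain
    (by rwa [P.left_end])
  obtain ⟨r, hrs, hrV, hr1, hr2⟩ := hG.exists_contracted_path P.right P.top P.right_chain
    (by rwa [P.right_end])
  have hnd := P.nodup
  by_cases ht : P.top ∈ V₁
  · obtain ⟨hlc, hll⟩ := hl1 ht
    obtain ⟨hrc, hrl⟩ := hr1 ht
    refine ⟨⟨P.top, l, r, hlc, hrc, hll.trans P.left_end, hrl.trans P.right_end,
      hnd.sublist ((hls.append hrs).cons_cons _)⟩, ?_, ?_⟩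
    · intro v hv
      simp only [Trek.support, List.mem_cons, List.mem_append] at hv
      rcases hv with rfl | hv | hv
      exacts [ht, hlV v hv, hrV v hv]
    · by_cases h : l.length = P.left.length ∧ r.length = P.right.length
      · left
        ext1
        exacts [rfl, hls.eq_of_length h.1, hrs.eq_of_length h.2]
      · right
        have h1 := hls.length_le
        have h2 := hrs.length_le
        simp only [Trek.length]
        omega
  -- If the top is outside, the two sides enter `V₁` at distinct vertices of the exit clique. These
  -- are adjacent; the source of that edge becomes the new top, and an edge is saved.
  · obtain ⟨y, l, rfl, ⟨a, ha, hay⟩, -, hlc, hll⟩ := hl2 ht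
    obtain ⟨z, r, rfl, ⟨b, hb, hbz⟩, -, hrc, hrl⟩ := hr2 ht
    have hy := hlV y (by simp)
    have hz := hrV z (by simp)
    have hnd' : (y :: l ++ z :: r).Nodup := hnd.sublist ((hls.append hrs).trans
      (List.sublist_cons_self _ _))
    have hyz : y ≠ z := by
      rintro rfl
      simp at hnd'
    have h1 := hls.length_le
    have h2 := hrs.length_le
    simp only [List.length_cons] at h1 h2
    rcases hG.exit_clique a b y z ha hb hy hz hay hbz hyz with h | h
    · refine ⟨⟨y, l, z :: r, hlc, List.isChain_cons_cons.mpr ⟨h, hrc⟩, hll.trans P.left_end, ?_,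
        hnd'⟩, fun v hv => ?_, .inr ?_⟩
      · rw [List.getLast_cons_cons]
        exact hrl.trans P.right_end
      · simp only [Trek.support, List.mem_cons, List.mem_append] at hv
        rcases hv with rfl | hv | rfl | hv
        exacts [hy, hlV v (by simp [hv]), hz, hrV v (by simp [hv])]
      · simp only [Trek.length, List.length_cons]
        omega
    · refine ⟨⟨z, y :: l, r, List.isChain_cons_cons.mpr ⟨h, hlc⟩, hrc, ?_, hrl.trans P.right_end,
        List.nodup_middle.mp hnd'⟩, fun v hv => ?_, .inr ?_⟩
      · rw [List.getLast_cons_cons]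
        exact hll.trans P.left_end
      · simp only [Trek.support, List.mem_cons, List.mem_append] at hv
        rcases hv with rfl | (rfl | hv) | hv
        exacts [hz, hy, hlV v (by simp [hv]), hrV v (by simp [hv])]
      · simp only [Trek.length, List.length_cons]
        omega

/-- A trek of a subgraph as a trek of the graph. -/
def Trek.incl (hadj : ∀ u v : V₁, G₁.Adj u v ↔ G.Adj u v) {i j : V₁} (P : G₁.Trek i j) :
    G.Trek (i : V) (j : V) where
  top := P.top
  left := P.left.map Subtype.val
  right := P.right.map Subtype.val
  left_chain := by
    rw [List.isChain_cons_map]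
    exact P.left_chain.imp fun u v h => (hadj u v).mp h
  right_chain := by
    rw [List.isChain_cons_map]
    exact P.right_chain.imp fun u v h => (hadj u v).mp h
  left_end := by
    simp only [← List.map_cons, List.getLast_map, P.left_end]
  right_end := by
    simp only [← List.map_cons, List.getLast_map, P.right_end]
  nodup := by
    rw [← List.map_append, ← List.map_cons]
    exact P.nodup.map Subtype.val_injective

theorem Trek.length_incl (hadj : ∀ u v : V₁, G₁.Adj u v ↔ G.Adj u v) {i j : V₁}
    (P : G₁.Trek i j) : (P.incl hadj).length = P.length := by
  simp [Trek.length, Trek.incl]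

theorem Trek.exists_incl_eq (hadj : ∀ u v : V₁, G₁.Adj u v ↔ G.Adj u v) {i j : V₁}
    (Q : G.Trek (i : V) (j : V)) (hQ : ∀ v ∈ Q.support, v ∈ V₁) :
    ∃ P : G₁.Trek i j, P.incl hadj = Q := by
  obtain ⟨t, l, r, hl, hr, hle, hre, hnd⟩ := Q
  simp only [Trek.support] at hQ
  lift t to V₁ using hQ t (by simp)
  lift l to List V₁ using fun v hv => hQ v (by simp [hv])
  lift r to List V₁ using fun v hv => hQ v (by simp [hv])
  refine ⟨⟨t, l, r, ?_, ?_, ?_, ?_, ?_⟩, rfl⟩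
  · rw [List.isChain_cons_map] at hl
    exact hl.imp fun u v h => (hadj u v).mpr h
  · rw [List.isChain_cons_map] at hr
    exact hr.imp fun u v h => (hadj u v).mpr h
  · simp only [← List.map_cons, List.getLast_map] at hle
    exact Subtype.ext hle
  · simp only [← List.map_cons, List.getLast_map] at hre
    exact Subtype.ext hre
  · rw [← List.map_append, ← List.map_cons] at hnd
    exact hnd.of_map _

theorem IsMarginal.isEmpty_trek (hG : G.IsMarginal G₁ c) {i j : V₁} (h : IsEmpty (G₁.Trek i j)) :
    IsEmpty (G.Trek (i : V) (j : V)) := by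
  refine ⟨fun P => ?_⟩
  obtain ⟨Q, hQ, -⟩ := hG.exists_contracted_trek i.2 j.2 P
  obtain ⟨R, -⟩ := Q.exists_incl_eq hG.adj_iff hQ
  exact h.false R

theorem IsMarginal.isShortest_incl (hG : G.IsMarginal G₁ c) {i j : V₁} {P : G₁.Trek i j}
    (hP : P.IsShortest) : (P.incl hG.adj_iff).IsShortest := by
  intro Q
  obtain ⟨Q', hQ', h⟩ := hG.exists_contracted_trek i.2 j.2 Q
  obtain ⟨R, rfl⟩ := Q'.exists_incl_eq hG.adj_iff hQ'
  have h1 := hP R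
  simp only [Trek.length_incl] at h ⊢
  rcases h with rfl | h
  · rwa [Trek.length_incl]
  · omega

/-- A shortest trek cannot be shortened by contraction, so it is its own contraction and comes from
`G₁`. -/
theorem IsMarginal.existsUnique_isShortest (hG : G.IsMarginal G₁ c)
    (h₁ : G₁.HasUniqueShortestTreks) {i j : V} (hi : i ∈ V₁) (hj : j ∈ V₁)
    (hne : Nonempty (G.Trek i j)) : ∃! P : G.Trek i j, P.IsShortest := by
  lift i to V₁ using hi
  lift j to V₁ using hj
  have h : Nonempty (G₁.Trek i j) := by
    by_contra h
    exact not_isEmpty_of_nonempty _ (hG.isEmpty_trek (not_nonempty_iff.mp h))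
  obtain ⟨P, hP, hu⟩ := h₁ i j h
  refine ⟨P.incl hG.adj_iff, hG.isShortest_incl hP, fun Q hQ => ?_⟩
  obtain ⟨Q', hQ', h⟩ := hG.exists_contracted_trek i.2 j.2 Q
  obtain rfl := h.resolve_right (not_lt.mpr (hQ Q'))
  obtain ⟨R, rfl⟩ := Q'.exists_incl_eq hG.adj_iff hQ'
  rw [hu R fun S => ?_]
  simpa [Trek.length_incl] using hQ (S.incl hG.adj_iff)

/-- An edge of a subgraph as an edge of the graph. -/
def edgeIncl (hadj : ∀ u v : V₁, G₁.Adj u v ↔ G.Adj u v) (e : G₁.Edge) : G.Edge :=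
  ⟨(e.1.1, e.1.2), (hadj _ _).mp e.2⟩

theorem edgeIncl_injective (hadj : ∀ u v : V₁, G₁.Adj u v ↔ G.Adj u v) :
    Function.Injective (edgeIncl hadj) := by
  rintro ⟨⟨a, b⟩, h⟩ ⟨⟨a', b'⟩, h'⟩ hab
  simp only [edgeIncl, Subtype.mk.injEq, Prod.mk.injEq] at hab
  obtain ⟨h1, h2⟩ := hab
  obtain rfl := Subtype.ext h1
  obtain rfl := Subtype.ext h2
  rfl

variable [Fintype V]

theorem Trek.monomial_incl (hadj : ∀ u v : V₁, G₁.Adj u v ↔ G.Adj u v) {i j : V₁}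
    (P : G₁.Trek i j) : (P.incl hadj).monomial =
      MvPolynomial.rename (Sum.map Subtype.val (edgeIncl hadj)) P.monomial := by
  classical
  have hedges : (P.incl hadj).edges =
      P.edges.map (Prod.map Subtype.val Subtype.val) := by
    simp only [Trek.edges, Trek.incl, List.map_append, ← List.map_cons, List.zip_map]
  simp only [Trek.monomial, map_mul, map_prod, apply_ite, map_one, MvPolynomial.rename_X,
    Sum.map_inl, Sum.map_inr, hedges]
  congr 1
  refine (Fintype.prod_of_injective _ (edgeIncl_injective hadj) _ _ (fun e he => ?_)
    fun e => ?_).symm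
  · rw [if_neg]
    intro h
    obtain ⟨⟨a, b⟩, -, hab⟩ := List.mem_map.mp h
    refine he ⟨⟨(a, b), (hadj a b).mpr ?_⟩, Subtype.ext hab⟩
    have := e.2
    rwa [← hab] at this
  · have : (edgeIncl hadj e).1 ∈ P.edges.map (Prod.map Subtype.val Subtype.val) ↔
        e.1 ∈ P.edges :=
      List.mem_map_of_injective (f := Prod.map Subtype.val Subtype.val)
        (Subtype.val_injective.prodMap Subtype.val_injective) (a := e.1)
    by_cases h : e.1 ∈ P.edges
    · rw [if_pos h, if_pos (this.mpr h)]
    · rw [if_neg h, if_neg (fun h' => h (this.mp h'))]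

theorem IsMarginal.rename_mem_shortestTrekIdeal (hG : G.IsMarginal G₁ c)
    (hST : G.HasUniqueShortestTreks) (h₁ : G₁.HasUniqueShortestTreks)
    {f : MvPolynomial (Sym2 V₁) ℂ} (hf : f ∈ G₁.shortestTrekIdeal) :
    MvPolynomial.rename (Sym2.map Subtype.val) f ∈ G.shortestTrekIdeal := by
  have h : G.shortestTrekMap.comp (MvPolynomial.rename (Sym2.map Subtype.val)) =
      (MvPolynomial.rename (Sum.map Subtype.val (edgeIncl hG.adj_iff))).comp
        G₁.shortestTrekMap := by
    ext1 s
    induction s with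
    | _ i j =>
    simp only [AlgHom.comp_apply, MvPolynomial.rename_X, Sym2.map_mk]
    by_cases hP : Nonempty (G₁.Trek i j)
    · obtain ⟨P, hP, -⟩ := h₁ i j hP
      rw [shortestTrekMap_X h₁ P hP, shortestTrekMap_X hST _ (hG.isShortest_incl hP),
        Trek.monomial_incl]
    · rw [not_nonempty_iff] at hP
      rw [shortestTrekMap_X_of_isEmpty hP, shortestTrekMap_X_of_isEmpty (hG.isEmpty_trek hP),
        map_zero]
  have h2 := DFunLike.congr_fun h f
  rw [AlgHom.comp_apply, AlgHom.comp_apply, show G₁.shortestTrekMap f = 0 from hf, map_zero] at h2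
  exact h2

/-- The relation found in the shortest trek ideal of `G₁` is also in its vanishing ideal by `hI`,
and both memberships pass to `G`. -/
theorem IsMarginal.reduces_X (hG : G.IsMarginal G₁ c)
    (hST : G.HasUniqueShortestTreks) (h₁ : G₁.HasUniqueShortestTreks)
    (hI : G₁.vanishingIdeal = G₁.shortestTrekIdeal) {i j : V} (hi : i ∈ V₁) (hj : j ∈ V₁) :
    G.Reduces (G.vanishingIdeal ⊓ G.shortestTrekIdeal) (MvPolynomial.X s(i, j)) := by
  obtain ⟨m, hm, h, hf⟩ := reduces_X_shortestTrekIdeal h₁ s(⟨i, hi⟩, ⟨j, hj⟩)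
  refine ⟨MvPolynomial.rename (Sym2.map Subtype.val) m, ?_,
    MvPolynomial.rename (Sum.map Subtype.val (edgeIncl hG.adj_iff)) h, ?_⟩
  · have : diagMonomials V₁ ≤ (diagMonomials V).comap
        (MvPolynomial.rename (R := ℂ) (Sym2.map (Subtype.val : V₁ → V))) := by
      refine Submonoid.closure_le.mpr ?_
      rintro _ ⟨v, rfl⟩
      simpa using X_mem_diagMonomials (v : V)
    exact this hm
  · have h1 : MvPolynomial.rename G.coord
        (MvPolynomial.rename (Sum.map Subtype.val (edgeIncl hG.adj_iff)) h) =
        MvPolynomial.rename (Sym2.map Subtype.val) (MvPolynomial.rename G₁.coord h) := by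
      rw [MvPolynomial.rename_rename, MvPolynomial.rename_rename]
      congr 2
      ext1 x
      rcases x with v | e <;> rfl
    have h2 : MvPolynomial.rename (R := ℂ) (Sym2.map Subtype.val) (MvPolynomial.X
        s((⟨i, hi⟩ : V₁), (⟨j, hj⟩ : V₁))) = MvPolynomial.X s(i, j) := by
      simp
    rw [h1, ← h2, ← map_mul, ← map_sub]
    exact ⟨hG.rename_mem (hI ▸ hf), hG.rename_mem_shortestTrekIdeal hST h₁ hf⟩

end Contraction

end DAG

/-! ### Treks and covariances across the gluing -/

namespace DAG

variable {V : Type*} {G : DAG V} {V₁ V₂ : Finset V} {G₁ : DAG V₁} {G₂ : DAG V₂} {c : V}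

theorem IsMarginal.forall_mem_path_notMem (hG : G.IsMarginal G₁ c) (l : List V) :
    ∀ x, (x :: l).IsChain G.Adj → (x :: l).getLast (List.cons_ne_nil _ _) ∉ V₁ → c ∉ x :: l →
      ∀ v ∈ x :: l, v ∉ V₁ := by
  induction l with
  | nil =>
    intro x _ hx _ v hv
    rwa [List.mem_singleton.mp hv]
  | cons y l ih =>
    intro x hx hlast hc
    rw [List.isChain_cons_cons] at hx
    rw [List.getLast_cons_cons] at hlast
    have h := ih y hx.2 hlast fun h => hc (List.mem_cons_of_mem _ h)
    intro v hv
    rcases List.mem_cons.mp hv with rfl | hv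
    · exact (hG.entrance _ y hx.1 (h y (by simp))).resolve_right
        (by rintro rfl; simp at hc)
    · exact h v hv

theorem IsMarginal.forall_mem_tail_notMem (hG : G.IsMarginal G₁ c) {x : V} {l : List V}
    (hl : (x :: l).IsChain G.Adj) (hlast : (x :: l).getLast (List.cons_ne_nil _ _) ∉ V₁)
    (hc : c ∉ l) : ∀ v ∈ l, v ∉ V₁ := by
  cases l with
  | nil => simp
  | cons y l =>
    rw [List.isChain_cons_cons] at hl
    rw [List.getLast_cons_cons] at hlast
    exact hG.forall_mem_path_notMem l y hl.2 hlast hc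

theorem reflTransGen_getLast {l : List V} : ∀ {x : V}, (x :: l).IsChain G.Adj →
    ∀ v ∈ x :: l, Relation.ReflTransGen G.Adj v ((x :: l).getLast (List.cons_ne_nil _ _)) := by
  induction l with
  | nil =>
    intro x _ v hv
    rw [List.mem_singleton.mp hv]
    exact .refl
  | cons y l ih =>
    intro x hx v hv
    rw [List.isChain_cons_cons] at hx
    rw [List.getLast_cons_cons]
    rcases List.mem_cons.mp hv with rfl | hv
    · exact .head hx.1 (ih hx.2 y (by simp))
    · exact ih hx.2 v hv

theorem transGen_getLast {l : List V} {x : V} (hx : (x :: l).IsChain G.Adj) {v : V}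
    (hv : v ∈ x :: l) (hne : v ≠ (x :: l).getLast (List.cons_ne_nil _ _)) :
    Relation.TransGen G.Adj v ((x :: l).getLast (List.cons_ne_nil _ _)) :=
  (Relation.reflTransGen_iff_eq_or_transGen.mp (reflTransGen_getLast hx v hv)).resolve_left
    hne.symm

/-- The trek `P` consists of the trek `Q` and the directed path `R` from `c`. -/
structure Trek.IsConcat {i j : V} (P : G.Trek i j) (R : G.Trek i c) (Q : G.Trek c j) : Prop where
  top : P.top = Q.top
  left : P.left = Q.left ++ R.left
  right : P.right = Q.right
  top_eq : R.top = c
  right_eq : R.right = []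

theorem Trek.IsConcat.length_eq {i j : V} {P : G.Trek i j} {R : G.Trek i c} {Q : G.Trek c j}
    (h : P.IsConcat R Q) : P.length = R.length + Q.length := by
  simp only [Trek.length, h.left, h.right, h.right_eq, List.length_append, List.length_nil]
  omega

theorem Trek.IsConcat.unique {i j : V} {P P' : G.Trek i j} {R : G.Trek i c} {Q : G.Trek c j}
    (h : P.IsConcat R Q) (h' : P'.IsConcat R Q) : P = P' := by
  ext1
  · rw [h.top, h'.top]
  · rw [h.left, h'.left]
  · rw [h.right, h'.right]

/-- Two marginals that cover the graph and overlap in `c`, such that all treks between `c` and the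
vertices outside of the second one are directed paths from `c`. -/
structure IsDirectedGluing (G : DAG V) (G₁ : DAG V₁) (G₂ : DAG V₂) (c : V) : Prop where
  fst : G.IsMarginal G₁ c
  snd : G.IsMarginal G₂ c
  cover : ∀ v, v ∈ V₁ ∨ v ∈ V₂
  not_transGen : ∀ a, a ∉ V₂ → ¬ Relation.TransGen G.Adj a c

variable {i j : V}

/-- If the top were not `c`, the side towards `i` would avoid `c` and so lie outside `V₂`, making
the top an ancestor of `c` outside `V₂`. -/
theorem IsDirectedGluing.trek_to (hG : G.IsDirectedGluing G₁ G₂ c) (hi : i ∉ V₂)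
    (R : G.Trek i c) : R.top = c ∧ R.right = [] ∧ ∀ v ∈ R.left, v ∉ V₂ := by
  have hcV : ∀ {v}, v ∉ V₂ → v ≠ c := fun hv h => hv (h ▸ hG.snd.mem)
  have hnd := R.nodup
  have htop : R.top = c := by
    by_contra htop
    have hcr : c ∈ R.right := by
      have := List.getLast_mem (List.cons_ne_nil R.top R.right)
      rw [R.right_end] at this
      exact (List.mem_cons.mp this).resolve_left (Ne.symm htop)
    have hcl : c ∉ R.top :: R.left := by
      intro h
      rcases List.mem_cons.mp h with h | h
      · exact htop h.symm
      · simp only [List.nodup_cons, List.nodup_append] at hnd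
        exact hnd.2.2.2 c h c hcr rfl
    have h1 := hG.snd.forall_mem_path_notMem _ _ R.left_chain (by rwa [R.left_end]) hcl R.top
      (by simp)
    have h2 := transGen_getLast R.right_chain (v := R.top) (by simp) (by rwa [R.right_end])
    rw [R.right_end] at h2
    exact hG.not_transGen _ h1 h2
  have hnd' := hnd
  rw [htop, List.nodup_cons] at hnd'
  refine ⟨htop, ?_, ?_⟩
  · by_contra hr
    have := List.getLast_mem hr
    have h1 := R.right_end
    rw [List.getLast_cons hr] at h1
    rw [h1] at this
    exact hnd'.1 (by simp [this])
  · exact hG.snd.forall_mem_tail_notMem R.left_chain (by rwa [R.left_end])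
      fun h => hnd'.1 (by simp [h])

theorem IsDirectedGluing.trek_from (hG : G.IsDirectedGluing G₁ G₂ c) (hj : j ∉ V₁)
    (Q : G.Trek c j) : ∀ v ∈ Q.support, v ∈ V₂ := by
  have hnd := Q.nodup
  have hcl : c ∈ Q.top :: Q.left := by
    have := List.getLast_mem (List.cons_ne_nil Q.top Q.left)
    rwa [Q.left_end] at this
  have hcr : c ∉ Q.right := by
    intro h
    rw [← List.cons_append, List.nodup_append] at hnd
    exact hnd.2.2 c hcl c h rfl
  intro v hv
  rw [Trek.support, ← List.cons_append, List.mem_append] at hv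
  rcases hv with hv | hv
  · by_contra hvV
    have := transGen_getLast Q.left_chain hv (by
      rw [Q.left_end]
      rintro rfl
      exact hvV hG.snd.mem)
    rw [Q.left_end] at this
    exact hG.not_transGen v hvV this
  · exact (hG.cover v).resolve_left (hG.fst.forall_mem_tail_notMem Q.right_chain
      (by rwa [Q.right_end]) hcr v hv)

/-- No vertex repeats, because `R` is outside `V₂` after `c` while `Q` is inside. -/
theorem IsDirectedGluing.exists_concat (hG : G.IsDirectedGluing G₁ G₂ c) (hi : i ∉ V₂)
    (hj : j ∉ V₁) (R : G.Trek i c) (Q : G.Trek c j) : ∃ P : G.Trek i j, P.IsConcat R Q := by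
  obtain ⟨htop, hright, hleft⟩ := hG.trek_to hi R
  have hQ := hG.trek_from hj Q
  have hRc := R.left_chain
  have hRe := R.left_end
  have hnd := R.nodup
  have hQe := Q.left_end
  simp only [htop, hright, List.append_nil] at hRc hRe hnd
  have hperm : (Q.top :: (Q.left ++ R.left ++ Q.right)).Perm
      (Q.top :: (Q.left ++ Q.right) ++ R.left) := by
    rw [List.cons_append, List.append_assoc, List.append_assoc]
    exact (List.perm_append_comm.append_left _).cons _
  refine ⟨⟨Q.top, Q.left ++ R.left, Q.right, ?_, Q.right_chain, ?_, Q.right_end, ?_⟩,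
    ⟨rfl, rfl, rfl, htop, hright⟩⟩
  · rw [← List.cons_append, List.isChain_append]
    refine ⟨Q.left_chain, hRc.tail, fun x hx y hy => ?_⟩
    rw [List.getLast?_eq_some_getLast (List.cons_ne_nil _ _), hQe, Option.mem_some_iff] at hx
    subst hx
    exact hRc.rel_head? hy
  · by_cases hl : R.left = []
    · simp only [hl, List.append_nil]
      rw [hQe, ← hRe]
      simp [hl]
    · simp only [← List.cons_append]
      rw [List.getLast_append_of_ne_nil _ hl]
      rwa [List.getLast_cons hl] at hRe
  · rw [hperm.nodup_iff, List.nodup_append]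
    exact ⟨Q.nodup, (List.nodup_cons.mp hnd).2, fun a ha b hb hab => hleft b hb (hab ▸ hQ a ha)⟩

theorem IsDirectedGluing.exists_split (hG : G.IsDirectedGluing G₁ G₂ c) (hi : i ∉ V₂)
    (hj : j ∉ V₁) (P : G.Trek i j) :
    ∃ (R : G.Trek i c) (Q : G.Trek c j), P.IsConcat R Q := by
  obtain ⟨t, l, r, hl, hr, hle, hre, hnd⟩ := P
  -- Otherwise the top is outside `V₂`. With `c` on the other side it would be an ancestor of `c`;
  -- without, it would be outside `V₁` as well.
  have hc : c ∈ t :: l := by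
    by_contra hc
    have h1 := hG.snd.forall_mem_path_notMem _ _ hl (by rwa [hle]) hc t (by simp)
    by_cases hcr : c ∈ t :: r
    · have h2 : Relation.TransGen G.Adj t c := by
        have h3 : c ∈ r := by
          rcases List.mem_cons.mp hcr with rfl | h
          · exact absurd hG.snd.mem h1
          · exact h
        obtain ⟨r₁, r₂, rfl⟩ := List.append_of_mem h3
        rw [List.isChain_cons_split] at hr
        have h5 : (t :: (r₁ ++ [c])).getLast (List.cons_ne_nil _ _) = c := by
          simp only [← List.cons_append, List.getLast_concat]
        have h4 := transGen_getLast hr.1 (v := t) (by simp) (by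
          rw [h5]
          rintro rfl
          exact h1 hG.snd.mem)
        rwa [h5] at h4
      exact hG.not_transGen t h1 h2
    · have h2 := hG.fst.forall_mem_path_notMem _ _ hr (by rwa [hre]) hcr t (by simp)
      exact (hG.cover t).elim h2 h1
  obtain ⟨l₁, l₂, hl₁₂, hlast⟩ : ∃ l₁ l₂, l = l₁ ++ l₂ ∧
      (t :: l₁).getLast (List.cons_ne_nil _ _) = c := by
    rcases List.mem_cons.mp hc with rfl | h
    · exact ⟨[], l, rfl, rfl⟩
    · obtain ⟨l₁, l₂, rfl⟩ := List.append_of_mem h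
      refine ⟨l₁ ++ [c], l₂, by simp, ?_⟩
      simp only [← List.cons_append, List.getLast_concat]
  subst hl₁₂
  have hl' := hl
  rw [← List.cons_append, List.isChain_append] at hl'
  have hc₂ : (c :: l₂).IsChain G.Adj := hl'.2.1.cons fun y hy => hl'.2.2 c (by
    rw [List.getLast?_eq_some_getLast (List.cons_ne_nil _ _), hlast]; rfl) y hy
  have hcl₁ : c ∈ t :: l₁ := by
    have := List.getLast_mem (List.cons_ne_nil t l₁)
    rwa [hlast] at this
  have hnd₁ : (t :: (l₁ ++ r)).Nodup :=
    hnd.sublist (((List.sublist_append_left l₁ l₂).append (List.Sublist.refl r)).cons_cons t)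
  have hnd₂ : (c :: l₂).Nodup := by
    have h1 : ((t :: l₁) ++ l₂).Nodup := by
      refine hnd.sublist ?_
      rw [List.cons_append]
      exact (List.sublist_append_left _ _).cons_cons t
    exact h1.sublist ((List.singleton_sublist.mpr hcl₁).append (List.Sublist.refl l₂))
  refine ⟨⟨c, l₂, [], hc₂, .singleton _, ?_, rfl, by simpa using hnd₂⟩,
    ⟨t, l₁, r, hl'.1, hr, hlast, hre, hnd₁⟩, ⟨rfl, rfl, rfl, rfl, rfl⟩⟩
  by_cases h : l₂ = []
  · subst h
    simp only [List.append_nil] at hle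
    rw [← hle, hlast]
    rfl
  · simp only [← List.cons_append] at hle
    rw [List.getLast_append_of_ne_nil _ h] at hle
    rw [List.getLast_cons h, hle]

theorem IsDirectedGluing.isShortest_of_isConcat (hG : G.IsDirectedGluing G₁ G₂ c) (hi : i ∉ V₂)
    (hj : j ∉ V₁) {P : G.Trek i j} {R : G.Trek i c} {Q : G.Trek c j} (h : P.IsConcat R Q)
    (hR : R.IsShortest) (hQ : Q.IsShortest) : P.IsShortest := by
  intro P'
  obtain ⟨R', Q', h'⟩ := hG.exists_split hi hj P'
  rw [h.length_eq, h'.length_eq]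
  exact add_le_add (hR R') (hQ Q')

theorem IsDirectedGluing.existsUnique_isShortest (hG : G.IsDirectedGluing G₁ G₂ c) (hi : i ∉ V₂)
    (hj : j ∉ V₁) (h₁ : G₁.HasUniqueShortestTreks) (h₂ : G₂.HasUniqueShortestTreks)
    (hne : Nonempty (G.Trek i j)) : ∃! P : G.Trek i j, P.IsShortest := by
  obtain ⟨P₀⟩ := hne
  obtain ⟨R₀, Q₀, -⟩ := hG.exists_split hi hj P₀
  obtain ⟨R, hR, hRu⟩ := hG.fst.existsUnique_isShortest h₁ ((hG.cover i).resolve_right hi)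
    hG.fst.mem ⟨R₀⟩
  obtain ⟨Q, hQ, hQu⟩ := hG.snd.existsUnique_isShortest h₂ hG.snd.mem
    ((hG.cover j).resolve_left hj) ⟨Q₀⟩
  obtain ⟨P, hP⟩ := hG.exists_concat hi hj R Q
  refine ⟨P, hG.isShortest_of_isConcat hi hj hP hR hQ, fun P' hP' => ?_⟩
  obtain ⟨R', Q', h'⟩ := hG.exists_split hi hj P'
  have h1 := hP' P
  rw [hP.length_eq, h'.length_eq] at h1
  have h2 := hR R'
  have h3 := hQ Q'
  have hR' : R' = R := hRu R' fun S => le_trans (by omega) (hR S)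
  have hQ' : Q' = Q := hQu Q' fun S => le_trans (by omega) (hQ S)
  subst hR' hQ'
  exact h'.unique hP

theorem zip_append_tail (l l' : List V) : ∀ t : V, (t :: (l ++ l')).zip (l ++ l') =
    (t :: l).zip l ++ ((t :: l).getLast (List.cons_ne_nil _ _) :: l').zip l' := by
  induction l with
  | nil => simp
  | cons y l ih =>
    intro t
    rw [List.getLast_cons_cons, List.cons_append, List.zip_cons_cons, ih y]
    rfl

theorem Trek.IsConcat.mem_edges {P : G.Trek i j} {R : G.Trek i c} {Q : G.Trek c j}
    (h : P.IsConcat R Q) (e : V × V) : e ∈ P.edges ↔ e ∈ R.edges ∨ e ∈ Q.edges := by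
  simp only [Trek.edges, h.top, h.left, h.right, h.top_eq, h.right_eq, zip_append_tail,
    Q.left_end, List.mem_append, List.zip_nil_right, List.not_mem_nil, or_false]
  tauto

/-- The edges of `R` point to vertices outside `V₂` and those of `Q` to vertices inside, so no λ is
shared; the extra factor is the top of `R`. -/
theorem IsDirectedGluing.monomial_mul [Fintype V] (hG : G.IsDirectedGluing G₁ G₂ c) (hi : i ∉ V₂)
    (hj : j ∉ V₁) {P : G.Trek i j} {R : G.Trek i c} {Q : G.Trek c j} (h : P.IsConcat R Q) :
    MvPolynomial.X (Sum.inl c) * P.monomial = R.monomial * Q.monomial := by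
  classical
  have hdisj : ∀ e, e ∈ R.edges → e ∉ Q.edges := by
    rintro ⟨x, y⟩ hR hQ
    have h1 : y ∉ V₂ := by
      simp only [Trek.edges, h.right_eq, List.zip_nil_right, List.append_nil] at hR
      exact (hG.trek_to hi R).2.2 y (List.of_mem_zip hR).2
    have h2 : y ∈ Q.left ∨ y ∈ Q.right := (List.mem_append.mp hQ).imp
      (fun h => (List.of_mem_zip h).2) fun h => (List.of_mem_zip h).2
    exact h1 (hG.trek_from hj Q y (by simpa [Trek.support] using .inr h2))
  simp only [Trek.monomial, h.top, h.top_eq]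
  rw [mul_mul_mul_comm, mul_assoc, ← Finset.prod_mul_distrib]
  congr 2
  refine Finset.prod_congr rfl fun e _ => ?_
  by_cases hR : e.1 ∈ R.edges
  · rw [if_pos ((h.mem_edges _).mpr (.inl hR)), if_pos hR, if_neg (hdisj _ hR), mul_one]
  · by_cases hQ : e.1 ∈ Q.edges
    · rw [if_pos ((h.mem_edges _).mpr (.inr hQ)), if_neg hR, if_pos hQ, one_mul]
    · rw [if_neg fun h' => ((h.mem_edges _).mp h').elim hR hQ, if_neg hR, if_neg hQ, one_mul]

theorem IsDirectedGluing.sub_mem_shortestTrekIdeal [Fintype V] (hG : G.IsDirectedGluing G₁ G₂ c)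
    (hi : i ∉ V₂) (hj : j ∉ V₁) (hST : G.HasUniqueShortestTreks) :
    MvPolynomial.X s(c, c) * MvPolynomial.X s(i, j) -
      MvPolynomial.X s(i, c) * MvPolynomial.X s(c, j) ∈ G.shortestTrekIdeal := by
  have hc : G.shortestTrekMap (MvPolynomial.X s(c, c)) = MvPolynomial.X (Sum.inl c) :=
    shortestTrekMap_coord_inl hST c
  rw [shortestTrekIdeal, RingHom.mem_ker, map_sub, map_mul, map_mul, hc, sub_eq_zero]
  by_cases hR : Nonempty (G.Trek i c)
  · by_cases hQ : Nonempty (G.Trek c j)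
    · obtain ⟨R, hR, -⟩ := hST _ _ hR
      obtain ⟨Q, hQ, -⟩ := hST _ _ hQ
      obtain ⟨P, hP⟩ := hG.exists_concat hi hj R Q
      rw [shortestTrekMap_X hST R hR, shortestTrekMap_X hST Q hQ,
        shortestTrekMap_X hST P (hG.isShortest_of_isConcat hi hj hP hR hQ)]
      exact hG.monomial_mul hi hj hP
    · have hP : IsEmpty (G.Trek i j) :=
        ⟨fun P => hQ ((hG.exists_split hi hj P).elim fun _ h => h.elim fun Q _ => ⟨Q⟩)⟩
      rw [shortestTrekMap_X_of_isEmpty hP,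
        shortestTrekMap_X_of_isEmpty (not_nonempty_iff.mp hQ), mul_zero, mul_zero]
  · have hP : IsEmpty (G.Trek i j) :=
      ⟨fun P => hR ((hG.exists_split hi hj P).elim fun R _ => ⟨R⟩)⟩
    rw [shortestTrekMap_X_of_isEmpty hP,
      shortestTrekMap_X_of_isEmpty (not_nonempty_iff.mp hR), mul_zero, zero_mul]

/-- Up to a multiple q of `X c`, the vector `X i` involves only errors outside `V₂`, whereas `X c`
and `X j` involve only errors inside. Hence σ_ij = q σ_cj and σ_ic = q σ_cc. -/
theorem IsDirectedGluing.sub_mem_vanishingIdeal [Fintype V] (hG : G.IsDirectedGluing G₁ G₂ c)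
    (hi : i ∉ V₂) (hj : j ∉ V₁) :
    MvPolynomial.X s(c, c) * MvPolynomial.X s(i, j) -
      MvPolynomial.X s(i, c) * MvPolynomial.X s(c, j) ∈ G.vanishingIdeal := by
  rw [vanishingIdeal, MvPolynomial.mem_vanishingIdeal_iff]
  intro p hp
  obtain ⟨lam, X, hX, hpX⟩ := exists_realizes_of_mem_model hp
  obtain ⟨q, hq, -⟩ := exists_sub_smul_mem_errorSpan (lam := lam) (X := X)
    (S := {v | v ∉ V₂}) (c := c) hG.snd.entrance hi
  obtain ⟨r, hr, -⟩ := exists_sub_smul_mem_errorSpan (lam := lam) (X := X)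
    (S := {v | v ∉ V₁}) (c := c) hG.fst.entrance hj
  have hc : X c ∈ G.errorSpan lam X {v | v ∈ V₂} := by
    refine errorSpan_mono ?_ (mem_errorSpan (S := {v | Relation.ReflTransGen G.Adj v c})
      (fun u v huv hv => .head huv hv) .refl)
    intro v hv
    by_contra hv'
    rcases Relation.reflTransGen_iff_eq_or_transGen.mp hv with rfl | h
    · exact hv' hG.snd.mem
    · exact hG.not_transGen v hv' h
  have hXj : X j ∈ G.errorSpan lam X {v | v ∈ V₂} := by
    have h1 := errorSpan_mono (G := G) (lam := lam) (X := X) (S := {v | v ∉ V₁})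
      (T := {v | v ∈ V₂}) (fun v hv => (hG.cover v).resolve_left hv) hr
    simpa using add_mem h1 (Submodule.smul_mem _ r hc)
  have hdisj : Disjoint {v | v ∉ V₂} {v | v ∈ V₂} :=
    Set.disjoint_left.mpr fun v h h' => h h'
  have h1 := hX.inner_eq_zero hdisj hq hXj
  have h2 := hX.inner_eq_zero hdisj hq hc
  rw [inner_sub_left, real_inner_smul_left, sub_eq_zero] at h1 h2
  simp only [map_sub, map_mul, MvPolynomial.aeval_X, hpX]
  rw [h1, h2]
  push_cast
  ring

theorem IsDirectedGluing.reduces_X [Fintype V] (hG : G.IsDirectedGluing G₁ G₂ c)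
    (hi : i ∉ V₂) (hj : j ∉ V₁) (hST : G.HasUniqueShortestTreks)
    (h₁ : G₁.HasUniqueShortestTreks) (hI₁ : G₁.vanishingIdeal = G₁.shortestTrekIdeal)
    (h₂ : G₂.HasUniqueShortestTreks) (hI₂ : G₂.vanishingIdeal = G₂.shortestTrekIdeal) :
    G.Reduces (G.vanishingIdeal ⊓ G.shortestTrekIdeal) (MvPolynomial.X s(i, j)) := by
  have h1 := hG.fst.reduces_X hST h₁ hI₁ ((hG.cover i).resolve_right hi) hG.fst.mem
  have h2 := hG.snd.reduces_X hST h₂ hI₂ hG.snd.mem ((hG.cover j).resolve_left hj)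
  exact Reduces.of_mul_sub_mem (X_mem_diagMonomials c) (h1.mul h2)
    ⟨hG.sub_mem_vanishingIdeal hi hj, hG.sub_mem_shortestTrekIdeal hi hj hST⟩

end DAG

namespace DAG

/-! ### Vertices without a trek are uncorrelated -/

section CommonAncestor

variable {V : Type*} {G : DAG V} {i j : V}

theorem nodup_of_isChain {l : List V} (hl : l.IsChain G.Adj) : l.Nodup := by
  have h : l.IsChain (Relation.TransGen G.Adj) := hl.imp fun _ _ h => .single h
  refine h.pairwise.imp fun {a b} hab => ?_
  rintro rfl
  exact G.acyclic a hab

theorem exists_trek_top_eq (h : Relation.ReflTransGen G.Adj i j) :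
    ∃ P : G.Trek i j, P.top = i ∧ P.left = [] := by
  obtain ⟨l, hl, hlast⟩ := List.exists_isChain_cons_of_relationReflTransGen h
  exact ⟨⟨i, [], l, .singleton _, hl, rfl, hlast, nodup_of_isChain hl⟩, rfl, rfl⟩

theorem nonempty_trek_of_common_ancestor [Finite V] {z : V}
    (hi : Relation.ReflTransGen G.Adj z i) (hj : Relation.ReflTransGen G.Adj z j) :
    Nonempty (G.Trek i j) := by
  have : Std.Irrefl (Function.swap (Relation.TransGen G.Adj)) := ⟨G.acyclic⟩
  have : IsTrans V (Function.swap (Relation.TransGen G.Adj)) := ⟨fun _ _ _ h h' => h'.trans h⟩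
  -- A lowest common ancestor: directed paths from it to `i` and `j` can meet nowhere else.
  obtain ⟨m, ⟨hmi, hmj⟩, hmin⟩ := (Finite.wellFounded_of_trans_of_irrefl
    (Function.swap (Relation.TransGen G.Adj))).has_min
    {z | Relation.ReflTransGen G.Adj z i ∧ Relation.ReflTransGen G.Adj z j} ⟨z, hi, hj⟩
  obtain ⟨l, hl, hli⟩ := List.exists_isChain_cons_of_relationReflTransGen hmi
  obtain ⟨r, hr, hrj⟩ := List.exists_isChain_cons_of_relationReflTransGen hmj
  refine ⟨⟨m, l, r, hl, hr, hli, hrj, ?_⟩⟩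
  have hl' := nodup_of_isChain hl
  have hr' := nodup_of_isChain hr
  rw [← List.cons_append, List.nodup_append]
  refine ⟨hl', (List.nodup_cons.mp hr').2, ?_⟩
  rintro v hv _ hv' rfl
  have h1 := reflTransGen_getLast hl v hv
  have h2 := reflTransGen_getLast hr v (List.mem_cons_of_mem _ hv')
  rw [hli] at h1
  rw [hrj] at h2
  have h : (m :: r).IsChain (Relation.TransGen G.Adj) := hr.imp fun _ _ h => .single h
  exact hmin v ⟨h1, h2⟩ (List.rel_of_pairwise_cons h.pairwise hv')

theorem X_mem_vanishingIdeal_of_isEmpty [Fintype V] (h : IsEmpty (G.Trek i j)) :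
    MvPolynomial.X s(i, j) ∈ G.vanishingIdeal := by
  rw [vanishingIdeal, MvPolynomial.mem_vanishingIdeal_iff]
  intro p hp
  obtain ⟨lam, X, hX, hpX⟩ := exists_realizes_of_mem_model hp
  have hmem : ∀ v, X v ∈ G.errorSpan lam X {u | Relation.ReflTransGen G.Adj u v} := fun v =>
    mem_errorSpan (S := {u | Relation.ReflTransGen G.Adj u v})
      (fun u w huw hw => .head huw hw) .refl
  rw [MvPolynomial.aeval_X, hpX, hX.inner_eq_zero ?_ (hmem i) (hmem j), Complex.ofReal_zero]
  refine Set.disjoint_left.mpr fun z hi hj => ?_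
  exact not_isEmpty_iff.mpr (nonempty_trek_of_common_ancestor hi hj) h

end CommonAncestor

/-! ### Nested parent sets from equality of the ideals -/

section NestedParents

variable {V : Type*} {G : DAG V} {a c k j : V}

theorem Trek.adj_of_length_eq_one (P : G.Trek k j) (h : P.length = 1) :
    G.Adj k j ∨ G.Adj j k := by
  obtain ⟨t, l, r, hl, hr, rfl, rfl, _⟩ := P
  simp only [Trek.length] at h
  rcases l with _ | ⟨x, _ | ⟨y, l⟩⟩
  · rcases r with _ | ⟨x, _ | ⟨y, r⟩⟩
    · simp at h
    · left
      simpa using hr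
    · simp at h
  · right
    obtain rfl : r = [] := List.length_eq_zero_iff.mp (by simpa using h)
    simpa using hl
  · simp only [List.length_cons] at h
    omega

variable [Fintype V]

/-- Without an edge between `a` and `j`, the path a → k → j is a shortest trek. -/
theorem mul_sub_mul_mem_shortestTrekIdeal (hG : G.HasUniqueShortestTreks) (hak : G.Adj a k)
    (hkj : G.Adj k j) (haj : ¬ G.Adj a j) :
    MvPolynomial.X s(a, j) * MvPolynomial.X s(k, k) -
      MvPolynomial.X s(a, k) * MvPolynomial.X s(k, j) ∈ G.shortestTrekIdeal := by
  classical
  have hajt : Relation.TransGen G.Adj a j := .tail (.single hak) hkj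
  have hne : a ≠ j := by
    rintro rfl
    exact G.acyclic _ hajt
  let P : G.Trek a j := ⟨a, [], [k, j], .singleton _, by simp [hak, hkj], rfl, rfl, by
    simp [ne_of_adj hak, ne_of_adj hkj, hne]⟩
  have hP : P.IsShortest := by
    intro Q
    by_contra! hQ
    have h2 : Q.length < 2 := hQ
    interval_cases h : Q.length
    · exact hne (Q.eq_of_length_eq_zero h)
    · rcases Q.adj_of_length_eq_one h with h | h
      · exact haj h
      · exact G.acyclic _ (hajt.tail h)
  have hmon : P.monomial = MvPolynomial.X (Sum.inl a) *
      (MvPolynomial.X (Sum.inr ⟨(a, k), hak⟩) * MvPolynomial.X (Sum.inr ⟨(k, j), hkj⟩)) := by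
    have h1 : ∀ (e' : G.Edge), MvPolynomial.X (R := ℂ) (Sum.inr e' : V ⊕ G.Edge) =
        ∏ e : G.Edge, if e = e' then MvPolynomial.X (Sum.inr e) else 1 := by simp
    rw [h1 ⟨(a, k), hak⟩, h1 ⟨(k, j), hkj⟩, ← Finset.prod_mul_distrib, Trek.monomial]
    congr 1
    refine Finset.prod_congr rfl fun e _ => ?_
    obtain ⟨⟨x, y⟩, hxy⟩ := e
    have hka := (ne_of_adj hak).symm
    by_cases h1 : x = a ∧ y = k
    · obtain ⟨rfl, rfl⟩ := h1
      simp [P, Trek.edges, ne_of_adj hak]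
    · by_cases h2 : x = k ∧ y = j
      · obtain ⟨rfl, rfl⟩ := h2
        simp [P, Trek.edges, hka]
      · simp [P, Trek.edges, h1, h2]
  have hk : G.shortestTrekMap (MvPolynomial.X s(k, k)) = MvPolynomial.X (Sum.inl k) :=
    shortestTrekMap_coord_inl hG k
  have h1 : G.shortestTrekMap (MvPolynomial.X s(a, k)) = _ :=
    shortestTrekMap_coord_inr hG ⟨(a, k), hak⟩
  have h2 : G.shortestTrekMap (MvPolynomial.X s(k, j)) = _ :=
    shortestTrekMap_coord_inr hG ⟨(k, j), hkj⟩
  rw [shortestTrekIdeal, RingHom.mem_ker, map_sub, map_mul, map_mul, hk, h1, h2,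
    shortestTrekMap_X hG P hP, hmon]
  ring

/-- Conditioning on `k` opens the collider a → k ← c, and c → j then makes `a` and `j` dependent. -/
theorem mul_sub_mul_notMem_vanishingIdeal (hac : a ≠ c) (hak : G.Adj a k) (hkj : G.Adj k j)
    (hck : G.Adj c k) (hcj : G.Adj c j) :
    MvPolynomial.X s(a, j) * MvPolynomial.X s(k, k) -
      MvPolynomial.X s(a, k) * MvPolynomial.X s(k, j) ∉ G.vanishingIdeal := by
  classical
  have hne : a ≠ j := by
    rintro rfl
    exact G.acyclic _ (.tail (.single hak) hkj)
  have hak' := ne_of_adj hak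
  have hkj' := ne_of_adj hkj
  have hck' := ne_of_adj hck
  have hcj' := ne_of_adj hcj
  let e : V → EuclideanSpace ℝ V := fun v => EuclideanSpace.single v 1
  have he : ∀ u v, ⟪e u, e v⟫_ℝ = if u = v then 1 else 0 := fun u v => by
    simp [e, EuclideanSpace.inner_single_left]
  -- Unit errors and coefficient 1 on a → k, c → k, c → j and k → j, and 0 elsewhere; the binomial
  -- takes the value 1·3 − 1·4 = −1.
  let X : V → EuclideanSpace ℝ V := fun v => if v = k then e a + e c + e k else
    if v = j then e a + (2 : ℝ) • e c + e k + e j else e v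
  let lam : V → V → ℝ := fun u v => (if u = a then if v = k then 1 else 0 else 0) +
    (if u = c then if v = k then 1 else 0 else 0) + (if u = c then if v = j then 1 else 0 else 0) +
    (if u = k then if v = j then 1 else 0 else 0)
  have hlam : ∀ u v, ¬ G.Adj u v → lam u v = 0 := by
    intro u v huv
    have h1 : ¬ (u = a ∧ v = k) := by rintro ⟨rfl, rfl⟩; exact huv hak
    have h2 : ¬ (u = c ∧ v = k) := by rintro ⟨rfl, rfl⟩; exact huv hck
    have h3 : ¬ (u = c ∧ v = j) := by rintro ⟨rfl, rfl⟩; exact huv hcj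
    have h4 : ¬ (u = k ∧ v = j) := by rintro ⟨rfl, rfl⟩; exact huv hkj
    simp only [lam, ← ite_and, h1, h2, h3, h4, if_false, add_zero]
  have hXa : X a = e a := by simp [X, hak', hne]
  have hXc : X c = e c := by simp [X, hck', hcj']
  have hXk : X k = e a + e c + e k := by simp [X]
  have hXj : X j = e a + (2 : ℝ) • e c + e k + e j := by simp [X, hkj'.symm]
  have hres : ∀ v, G.residual lam X v = e v := by
    intro v
    simp only [residual, coeff_eq_self hlam]
    have hsum : ∑ u, lam u v • X u = (if v = k then (1 : ℝ) else 0) • X a +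
        (if v = k then (1 : ℝ) else 0) • X c + (if v = j then (1 : ℝ) else 0) • X c +
        (if v = j then (1 : ℝ) else 0) • X k := by
      simp only [lam, add_smul, Finset.sum_add_distrib, ite_smul, zero_smul, Finset.sum_ite_eq',
        Finset.mem_univ, if_true]
    rw [hsum, hXa, hXc, hXk]
    by_cases hvk : v = k
    · subst hvk
      rw [hXk]
      simp [hkj']
    · by_cases hvj : v = j
      · subst hvj
        rw [hXj]
        simp only [hvk, if_false, if_true]
        module
      · simp [X, hvk, hvj]
  have hreal : G.Realizes lam X := by
    refine ⟨fun v h => ?_, fun u v huv => ?_⟩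
    · rw [hres] at h
      have := he v v
      rw [h, inner_zero_left] at this
      simp at this
    · rw [hres, hres, he, if_neg huv]
  intro hmem
  rw [vanishingIdeal, MvPolynomial.mem_vanishingIdeal_iff] at hmem
  have := hmem (fun s => s.lift ⟨fun u v => ((⟪X u, X v⟫_ℝ : ℝ) : ℂ), fun u v =>
    congrArg Complex.ofReal (real_inner_comm _ _)⟩) (hreal.mem_model fun u v => rfl)
  simp only [map_sub, map_mul, MvPolynomial.aeval_X, Sym2.lift_mk, hXa, hXk, hXj, inner_add_left,
    inner_add_right, real_inner_smul_right, he] at this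
  simp [hac, hac.symm, hak', hak'.symm, hkj', hck', hck'.symm, hcj', hne] at this
  norm_num at this

theorem adj_of_vanishingIdeal_eq (hG : G.HasUniqueShortestTreks)
    (hI : G.vanishingIdeal = G.shortestTrekIdeal) (hac : a ≠ c) (hak : G.Adj a k)
    (hkj : G.Adj k j) (hck : G.Adj c k) (hcj : G.Adj c j) : G.Adj a j := by
  by_contra haj
  exact mul_sub_mul_notMem_vanishingIdeal hac hak hkj hck hcj
    (hI ▸ mul_sub_mul_mem_shortestTrekIdeal hG hak hkj haj)

end NestedParents

/-! ### Safe gluings have the required structure -/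

section SafeGluing

variable {V : Type*} {G : DAG V} {V₁ V₂ : Finset V} {G₁ : DAG V₁} {G₂ : DAG V₂} {c : V}
  {C D : Finset V}

theorem IsCliqueSum.symm (h : G.IsCliqueSum G₁ G₂ C) : G.IsCliqueSum G₂ G₁ C where
  cover v := (h.cover v).symm
  inter v := and_comm.trans (h.inter v)
  same u v hu hv hu₁ hv₁ hu₂ hv₂ := (h.same u v hu hv hu₂ hv₂ hu₁ hv₁).symm
  complete u v hu hv huv hu₂ hv₂ := by
    have hu₁ := ((h.inter u).mpr hu).1
    have hv₁ := ((h.inter v).mpr hv).1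
    rw [← h.same u v hu hv hu₁ hv₁, ← h.same v u hv hu hv₁ hu₁]
    exact h.complete u v hu hv huv hu₁ hv₁
  adj u v := (h.adj u v).trans or_comm

theorem IsCliqueSum.adj_iff (h : G.IsCliqueSum G₁ G₂ C) (u v : V₁) :
    G₁.Adj u v ↔ G.Adj u v := by
  rw [h.adj]
  constructor
  · exact fun huv => .inl ⟨u.2, v.2, huv⟩
  · rintro (⟨_, _, huv⟩ | ⟨hu, hv, huv⟩)
    · exact huv
    · exact (h.same u v ((h.inter u).mp ⟨u.2, hu⟩) ((h.inter v).mp ⟨v.2, hv⟩) u.2 v.2 hu hv).mpr huv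

theorem IsCliqueSum.adj_of_mem (h : G.IsCliqueSum G₁ G₂ C) {u v : V} (hu : u ∈ C) (hv : v ∈ C)
    (huv : u ≠ v) : G.Adj u v ∨ G.Adj v u := by
  have hu₁ := ((h.inter u).mpr hu).1
  have hv₁ := ((h.inter v).mpr hv).1
  exact (h.complete u v hu hv huv hu₁ hv₁).imp (h.adj_iff ⟨u, hu₁⟩ ⟨v, hv₁⟩).mp
    (h.adj_iff ⟨v, hv₁⟩ ⟨u, hu₁⟩).mp

theorem IsCliqueSum.mem_snd (h : G.IsCliqueSum G₁ G₂ C) {u v : V} (huv : G.Adj u v)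
    (h' : u ∉ V₁ ∨ v ∉ V₁) : u ∈ V₂ ∧ v ∈ V₂ := by
  rcases (h.adj u v).mp huv with ⟨hu, hv, _⟩ | ⟨hu, hv, _⟩
  · exact absurd h' (by simp [hu, hv])
  · exact ⟨hu, hv⟩

theorem IsChokePoint.symm {I J : Set V} (h : G.IsChokePoint c I J) : G.IsChokePoint c J I := by
  refine ⟨fun j hj i hi P => ?_, h.2.symm.imp (fun h j hj i hi P => h i hi j hj P.symm)
    fun h j hj i hi P => h i hi j hj P.symm⟩
  have := h.1 i hi j hj P.symm
  simp only [Trek.support, Trek.symm, List.mem_cons, List.mem_append] at this ⊢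
  tauto

variable [DecidableEq V]

theorem IsSafeGluing.symm (h : G.IsSafeGluing G₁ G₂ c D) : G.IsSafeGluing G₂ G₁ c D where
  not_mem := h.not_mem
  cliqueSum := h.cliqueSum.symm
  safe := by
    refine h.safe.imp (fun h' => ⟨h'.1.symm, fun j hj i hi P d hd => ?_⟩) fun h' =>
      ⟨h'.1, fun j hj hjc i hi hic => ⟨fun P => (h'.2 i hi hic j hj hjc).false P.symm⟩⟩
    have := h'.2 i hi j hj P.symm d hd
    simp only [Trek.support, Trek.symm, List.mem_cons, List.mem_append] at this ⊢
    tauto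

theorem IsSafeGluing.mem_fst (h : G.IsSafeGluing G₁ G₂ c D) : c ∈ V₁ :=
  ((h.cliqueSum.inter c).mpr (Finset.mem_insert_self c D)).1

theorem IsSafeGluing.mem_diff (h : G.IsSafeGluing G₁ G₂ c D) : c ∈ (↑V₁ \ ↑D : Set V) :=
  ⟨h.mem_fst, h.not_mem⟩

theorem IsSafeGluing.mem_diff_of_notMem (h : G.IsSafeGluing G₁ G₂ c D) {v : V} (hv : v ∉ V₁) :
    v ∈ (↑V₂ \ ↑D : Set V) :=
  ⟨(h.cliqueSum.cover v).resolve_left hv, fun hD =>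
    hv ((h.cliqueSum.inter v).mpr (Finset.mem_insert_of_mem hD)).1⟩

theorem IsSafeGluing.notMem_support (h : G.IsSafeGluing G₁ G₂ c D) {d v : V} (hd : d ∈ D)
    (hv : v ∉ V₁) (P : G.Trek c v) : d ∉ P.support := by
  rcases h.safe with h' | h'
  · exact h'.2 c h.mem_diff v (h.mem_diff_of_notMem hv) P d hd
  · simp [h'.1] at hd

theorem IsSafeGluing.entrance (h : G.IsSafeGluing G₁ G₂ c D) {u v : V} (huv : G.Adj u v)
    (hv : v ∉ V₁) : u ∉ V₁ ∨ u = c := by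
  by_contra! hu
  have huC := (h.cliqueSum.inter u).mp ⟨hu.1, (h.cliqueSum.mem_snd huv (.inr hv)).1⟩
  have huD := (Finset.mem_insert.mp huC).resolve_left hu.2
  have hvc : v ≠ c := fun hvc => hv (hvc ▸ h.mem_fst)
  -- Whatever the direction of the edge between `u` and `c`, it forms with u → v a trek from `c` to
  -- `v` through `u ∈ D`, which safety forbids.
  rcases h.cliqueSum.adj_of_mem huC (Finset.mem_insert_self c D) hu.2 with huc | hcu
  · exact h.notMem_support huD hv ⟨u, [c], [v], by simpa, by simpa, rfl, rfl, by
      simp [hu.2, ne_of_adj huv, hvc.symm]⟩ (by simp [Trek.support])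
  · exact h.notMem_support huD hv ⟨c, [], [u, v], by simp, by simp [hcu, huv], rfl, rfl, by
      simp [hu.2.symm, ne_of_adj huv, hvc.symm]⟩ (by simp [Trek.support])

theorem IsSafeGluing.exit (h : G.IsSafeGluing G₁ G₂ c D) {b j : V} (hbj : G.Adj b j)
    (hb : b ∉ V₁) (hj : j ∈ V₁) : j = c ∨ (j ∈ D ∧ G.Adj c j) := by
  have hjC := (h.cliqueSum.inter j).mp ⟨hj, (h.cliqueSum.mem_snd hbj (.inl hb)).2⟩
  rcases Finset.mem_insert.mp hjC with rfl | hjD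
  · exact .inl rfl
  have hjc : j ≠ c := fun hjc => h.not_mem (hjc ▸ hjD)
  have hbc : b ≠ c := fun hbc => hb (hbc ▸ h.mem_fst)
  refine .inr ⟨hjD, (h.cliqueSum.adj_of_mem hjC (Finset.mem_insert_self c D) hjc).resolve_left
    fun hjc' => ?_⟩
  exact h.notMem_support hjD hb ⟨b, [j, c], [], by simp [hbj, hjc'], by simp, rfl, rfl, by
    simp [ne_of_adj hbj, hbc, hjc]⟩ (by simp [Trek.support])

theorem IsSafeGluing.isMarginal (h : G.IsSafeGluing G₁ G₂ c D)
    (hST : G₁.HasUniqueShortestTreks) (hI : G₁.vanishingIdeal = G₁.shortestTrekIdeal) :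
    G.IsMarginal G₁ c where
  mem := h.mem_fst
  adj_iff := h.cliqueSum.adj_iff
  entrance _ _ huv hv := h.entrance huv hv
  exit_clique a b i j ha hb hi hj hai hbj hij :=
    h.cliqueSum.adj_of_mem
      ((h.cliqueSum.inter i).mp ⟨hi, (h.cliqueSum.mem_snd hai (.inl ha)).2⟩)
      ((h.cliqueSum.inter j).mp ⟨hj, (h.cliqueSum.mem_snd hbj (.inl hb)).2⟩) hij
  exit_child b j hb hj hbj := (h.exit hbj hb hj).imp_right And.right
  nested a b i j ha hb hi hj hai hbj hij k hk hki := by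
    rcases h.exit hbj hb hj with rfl | ⟨hjD, hcj⟩
    · rcases h.exit hai ha hi with rfl | ⟨_, hji⟩
      · exact hki
      · exact absurd (.tail (.single hij) hji) (G.acyclic i)
    have hkj : Relation.TransGen G.Adj k j := .tail (.single hki) hij
    -- If `k` is in the clique, acyclicity orients its edge with `j`. If not, `i = c` would give `c`
    -- parents strictly on both sides, against the choke point; so c → i, and equality of the ideals
    -- of `G₁` forces the edge.
    by_cases hk₂ : k ∈ V₂
    · refine (h.cliqueSum.adj_of_mem ((h.cliqueSum.inter k).mp ⟨hk, hk₂⟩)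
        (Finset.mem_insert_of_mem hjD) ?_).resolve_right fun hjk => G.acyclic k (hkj.tail hjk)
      rintro rfl
      exact G.acyclic k hkj
    · have hkc : k ≠ c := fun hkc => hk₂ (hkc ▸ h.symm.mem_fst)
      rcases h.exit hai ha hi with rfl | ⟨_, hci⟩
      · exfalso
        rcases h.safe with ⟨⟨_, hl | hr⟩, _⟩ | h'
        · have := hl k (h.symm.mem_diff_of_notMem hk₂) i h.symm.mem_diff (Trek.single hki)
          simp [Trek.leftSide, Trek.single, hkc.symm] at this
        · have := hr i h.mem_diff a (h.mem_diff_of_notMem ha) (Trek.single hai).symm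
          simp [Trek.rightSide, Trek.symm, Trek.single, (ne_of_adj hai).symm] at this
        · simp [h'.1] at hjD
      · have := @h.cliqueSum.adj_iff
        exact (this ⟨k, hk⟩ ⟨j, hj⟩).mp (adj_of_vanishingIdeal_eq (c := ⟨c, h.mem_fst⟩)
          (k := ⟨i, hi⟩) hST hI (fun h => hkc (congrArg Subtype.val h)) ((this _ _).mpr hki)
          ((this _ _).mpr hij) ((this _ _).mpr hci) ((this _ _).mpr hcj))

theorem IsSafeGluing.isDirectedGluing (h : G.IsSafeGluing G₁ G₂ c D)
    (hST₁ : G₁.HasUniqueShortestTreks) (hI₁ : G₁.vanishingIdeal = G₁.shortestTrekIdeal)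
    (hST₂ : G₂.HasUniqueShortestTreks) (hI₂ : G₂.vanishingIdeal = G₂.shortestTrekIdeal)
    (hc : ∀ i ∈ (↑V₁ \ ↑D : Set V), ∀ j ∈ (↑V₂ \ ↑D : Set V), ∀ P : G.Trek i j, c ∈ P.leftSide) :
    G.IsDirectedGluing G₁ G₂ c where
  fst := h.isMarginal hST₁ hI₁
  snd := h.symm.isMarginal hST₂ hI₂
  cover := h.cliqueSum.cover
  not_transGen a ha hac := by
    -- A directed path from `a` to `c` is a trek whose side at `a` is `a` alone, so it misses `c`.
    obtain ⟨P, hP, hP'⟩ := exists_trek_top_eq hac.to_reflTransGen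
    have := hc a (h.symm.mem_diff_of_notMem ha) c h.symm.mem_diff P
    rw [Trek.leftSide, hP, hP', List.mem_singleton] at this
    exact ha (this ▸ h.symm.mem_fst)

theorem IsSafeGluing.cross [Fintype V] (h : G.IsSafeGluing G₁ G₂ c D)
    (hST₁ : G₁.HasUniqueShortestTreks) (hI₁ : G₁.vanishingIdeal = G₁.shortestTrekIdeal)
    (hST₂ : G₂.HasUniqueShortestTreks) (hI₂ : G₂.vanishingIdeal = G₂.shortestTrekIdeal)
    {i j : V} (hi : i ∉ V₂) (hj : j ∉ V₁) :
    (Nonempty (G.Trek i j) → ∃! P : G.Trek i j, P.IsShortest) ∧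
      (G.HasUniqueShortestTreks →
        G.Reduces (G.vanishingIdeal ⊓ G.shortestTrekIdeal) (MvPolynomial.X s(i, j))) := by
  rcases h.safe with ⟨⟨_, hc | hc⟩, _⟩ | ⟨_, hempty⟩
  · have hd := h.isDirectedGluing hST₁ hI₁ hST₂ hI₂ hc
    exact ⟨hd.existsUnique_isShortest hi hj hST₁ hST₂,
      fun hST => hd.reduces_X hi hj hST hST₁ hI₁ hST₂ hI₂⟩
  · have hd := h.symm.isDirectedGluing hST₂ hI₂ hST₁ hI₁ fun j hj i hi P => hc i hi j hj P.symm
    refine ⟨Trek.existsUnique_isShortest_symm (hd.existsUnique_isShortest hj hi hST₂ hST₁),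
      fun hST => ?_⟩
    rw [Sym2.eq_swap]
    exact hd.reduces_X hj hi hST hST₂ hI₂ hST₁ hI₁
  · have he := hempty i ((h.cliqueSum.cover i).resolve_right hi)
      (fun hic => hi (hic ▸ h.symm.mem_fst)) j ((h.cliqueSum.cover j).resolve_left hj)
      (fun hjc => hj (hjc ▸ h.mem_fst))
    exact ⟨fun hne => absurd he (not_isEmpty_iff.mpr hne), fun _ => reduces_of_mem
      ⟨X_mem_vanishingIdeal_of_isEmpty he, shortestTrekMap_X_of_isEmpty he⟩⟩

end SafeGluing

end DAG

/-! ### The theorem, by the position of i and j -/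

theorem mainTheorem2 {V : Type*} [Fintype V] [DecidableEq V] {V₁ V₂ : Finset V}
    (G₁ : DAG V₁) (G₂ : DAG V₂) (G : DAG V) (c : V) (D : Finset V)
    (hG : G.IsSafeGluing G₁ G₂ c D)
    (hST₁ : G₁.HasUniqueShortestTreks) (hI₁ : G₁.vanishingIdeal = G₁.shortestTrekIdeal)
    (hST₂ : G₂.HasUniqueShortestTreks) (hI₂ : G₂.vanishingIdeal = G₂.shortestTrekIdeal)
    (hgen : GeneratorsShareAtMost c G₁.vanishingIdeal G₂.vanishingIdeal) :
    G.HasUniqueShortestTreks ∧ G.vanishingIdeal = G.shortestTrekIdeal ∧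
      IsToricIdeal G.vanishingIdeal := by
  have h₁ := hG.isMarginal hST₁ hI₁
  have h₂ := hG.symm.isMarginal hST₂ hI₂
  have hcover := hG.cliqueSum.cover
  have hcases : ∀ i j : V, (i ∈ V₁ ∧ j ∈ V₁) ∨ (i ∈ V₂ ∧ j ∈ V₂) ∨ (i ∉ V₂ ∧ j ∉ V₁) ∨
      (j ∉ V₂ ∧ i ∉ V₁) := by
    intro i j
    have hi := hcover i
    have hj := hcover j
    tauto
  have hST : G.HasUniqueShortestTreks := by
    intro i j
    rcases hcases i j with h | h | h | h
    · exact h₁.existsUnique_isShortest hST₁ h.1 h.2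
    · exact h₂.existsUnique_isShortest hST₂ h.1 h.2
    · exact (hG.cross hST₁ hI₁ hST₂ hI₂ h.1 h.2).1
    · exact DAG.Trek.existsUnique_isShortest_symm (hG.cross hST₁ hI₁ hST₂ hI₂ h.1 h.2).1
  have hI : G.vanishingIdeal = G.shortestTrekIdeal := by
    refine DAG.vanishingIdeal_eq_shortestTrekIdeal hST fun s => ?_
    induction s with
    | _ i j =>
    rcases hcases i j with h | h | h | h
    · exact h₁.reduces_X hST hST₁ hI₁ h.1 h.2
    · exact h₂.reduces_X hST hST₂ hI₂ h.1 h.2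
    · exact (hG.cross hST₁ hI₁ hST₂ hI₂ h.1 h.2).2 hST
    · rw [Sym2.eq_swap]
      exact (hG.cross hST₁ hI₁ hST₂ hI₂ h.1 h.2).2 hST
  exact ⟨hST, hI, hI ▸ DAG.isToricIdeal_shortestTrekIdeal⟩
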